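/- Let $F$ be a field of characteristic $0$. For a Lie algebra $L$ over $F$, a 2-cocycle is a bilinear map $\psi:L\times L\to F$ with $\psi(x,y)=-\psi(y,x)$ and $\psi([x,y],z)+\psi([y,z],x)+\psi([z,x],y)=0$; a 2-coboundary is a map $\psi_f(x,y)=f([x,y])$ with $f:L\to F$ linear; and $H^2(L,F)$ is the space of 2-cocycles modulo the space of 2-coboundaries. Let $\ell_1,\ell_2,\ell_3,\ell_4\ge 0$ be integers with $\ell=\ell_1+\ell_2+\ell_3+\ell_4>0$. Let $\Gamma$ be an additive subgroup of $F^\ell$ whose elements have their first $\ell_1$ coordinates equal to $0$ and which, read in the last $\ell_2+\ell_3+\ell_4$ coordinates, contains an $F$-basis of $F^{\ell_2+\ell_3+\ell_4}$. Put $J=\mathbb Z_{\ge 0}^{\ell_1+\ell_2}\times\mathbb Z^{\ell_3}\times\{0\}^{\ell_4}\subset\mathbb Z^\ell$, and let $\mathcal A=F[\Gamma\times J]$ be the semigroup algebra with basis $x^{\alpha,i}$ and product $x^{\alpha,i}x^{\beta,j}=x^{\alpha+\beta,i+j}$. For $1\le p\le\ell$ let $\partial_p$ be the derivation of $\mathcal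 A$ with $\partial_p(x^{\alpha,i})=\alpha_p x^{\alpha,i}+i_p x^{\alpha,i-1_{[p]}}$, where $1_{[p]}$ is the $p$-th unit vector (a term with coefficient $0$ is omitted). Let $\mathcal W=\mathcal W(\ell_1,\ell_2,\ell_3,\ell_4,\Gamma)=\mathcal A\otimes F[\partial_1,\dots,\partial_\ell]$, with basis $x^{\alpha,i}\partial^\mu$ $(\alpha\in\Gamma,\ i\in J,\ \mu\in\mathbb Z_{\ge0}^\ell)$, be the associative algebra with product $$u\partial^\mu\odot v\partial^\nu=u\sum_{\lambda\in\mathbb Z_{\ge 0}^\ell}\binom{\mu}{\lambda}\partial^\lambda(v)\,\partial^{\mu+\nu-\lambda}\qquad(u,v\in\mathcal A),\qquad \binom\mu\lambda=\prod_{p=1}^{\ell}\binom{\mu_p}{\lambda_p},$$ regarded as a Lie algebra under the commutator. For $a\in F$ and an integer $k\ge0$ write $\binom ak=\frac{a(a-1)\cdots(a-k+1)}{k!}$. **Theorem 3.1.** (1) If $\ell_1+\ell_2\neq0$ or $\ell\ge2$, then $H^2(\mathcal W,F)=0$. (2) Suppose $\ell=\ell_4=1$; write $\partial=\partial_1$,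 $x^\alpha=x^{\alpha,0}$, regard $\Gamma\subseteq F$, and put $[\partial]_\mu=\partial(\partial-1)\cdots(\partial-\mu+1)$ for $\mu\in\mathbb Z_{\ge0}$. There is exactly one bilinear form $\phi_0$ on $\mathcal W$ with $$\phi_0\bigl(x^\alpha[\partial]_\mu,\,x^\beta[\partial]_\nu\bigr)=\delta_{\alpha+\beta,0}\,(-1)^\mu\mu!\,\nu!\binom{\alpha+\mu}{\mu+\nu+1}\qquad(\alpha,\beta\in\Gamma,\ \mu,\nu\in\mathbb Z_{\ge0}).$$ It is a 2-cocycle, its cohomology class $\overline\phi_0$ is not zero, and $H^2(\mathcal W,F)=F\,\overline\phi_0$. (3) Suppose $\ell=\ell_3=1$; write $\partial=\partial_1$ and regard $\Gamma\subseteq F$, $J=\mathbb Z$. For each $\gamma\in\Gamma$ the bilinear form $\phi_\gamma$ on $\mathcal W$ with $$\phi_\gamma\bigl(x^{\alpha,i}\partial^\mu,\,x^{\beta,j}\partial^\nu\bigr)=\delta_{\alpha+\beta,\gamma}\,(-1)^\mu\mu!\,\nu!\sum_{s=0}^{\mu+\nu+1}\binom is\frac{\alpha^{\mu+\nu+1-s}}{(\mu+\nu+1-s)!}\cdot\frac{\gamma^{\,s-i-j-1}}{(s-i-j-1)!}$$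 for $\alpha,\beta\in\Gamma$, $i,j\in\mathbb Z$, $\mu,\nu\in\mathbb Z_{\ge0}$ is a 2-cocycle; here $\gamma^k/k!$ is read as $0$ for $k<0$, and $0^0=1$. Moreover $H^2(\mathcal W,F)$ is the direct product $\prod_{\gamma\in\Gamma}F\,\overline\phi_\gamma$ in the following sense: for all $u,v\in\mathcal W$ only finitely many $\phi_\gamma(u,v)$ are nonzero; for every family $(b_\gamma)_{\gamma\in\Gamma}$ in $F$ the form $\sum_{\gamma\in\Gamma} b_\gamma\phi_\gamma$ is a 2-cocycle; and the map that sends $(b_\gamma)_{\gamma\in\Gamma}$ to the class of $\sum_{\gamma}b_\gamma\phi_\gamma$ is a linear isomorphism from $F^\Gamma$ onto $H^2(\mathcal W,F)$. -/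

import Mathlib

set_option maxSynthPendingDepth 3

namespace GenDiffOp

noncomputable section

section Weyl

universe uA

variable {F : Type*} {A : Type uA} [CommRing F] [CommRing A] [Algebra F A] {n : ℕ}

/-- The operator `∂^κ = ∂₁^{κ₁} ⋯ ∂ₙ^{κₙ}` on `A`, for commuting operators `∂₁, …, ∂ₙ`. -/
def dpow (d : Fin n → Module.End F A) (κ : Fin n → ℕ) : Module.End F A :=
  (List.ofFn fun p => d p ^ κ p).prod

/-- The product `u∂^μ ⊙ v∂^ν = u ∑_κ (μ choose κ) ∂^κ(v) ∂^{μ+ν-κ}` on `A ⊗ F[∂₁, …, ∂ₙ]`,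
extended bilinearly. An element of `A ⊗ F[∂₁, …, ∂ₙ]` is the finitely supported function that
sends `μ` to the coefficient `u ∈ A` of `∂^μ`. The sum runs over the `κ ≤ μ` only, since the
binomial coefficient is zero otherwise. -/
def weylMul (d : Fin n → Module.End F A) (P Q : (Fin n → ℕ) →₀ A) : (Fin n → ℕ) →₀ A :=
  P.sum fun μ u => Q.sum fun ν v =>
    ∑ κ ∈ Fintype.piFinset (fun p => Finset.range (μ p + 1)),
      Finsupp.single (μ + ν - κ) ((∏ p, (μ p).choose (κ p)) • (u * dpow d κ v))

section Assoc

def mapCoeff : Module.End F A →* Module.End F ((Fin n → ℕ) →₀ A) where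
  toFun T := Finsupp.mapRange.linearMap T
  map_one' := by ext; simp
  map_mul' S T := by ext; simp

def shift (p : Fin n) : Module.End F ((Fin n → ℕ) →₀ A) :=
  Finsupp.lmapDomain A F (fun ν => Pi.single p 1 + ν)

theorem mapCoeff_single (T : Module.End F A) (ν : Fin n → ℕ) (v : A) :
    mapCoeff T (Finsupp.single ν v) = Finsupp.single ν (T v) := by
  simp [mapCoeff]

theorem shift_single (p : Fin n) (ν : Fin n → ℕ) (v : A) :
    shift (F := F) p (Finsupp.single ν v) = Finsupp.single (Pi.single p 1 + ν) v := by
  simp [shift, Finsupp.mapDomain_single]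

theorem exists_comm (d : Fin n → Module.End F A) (hd : ∀ p q, d p * d q = d q * d p) :
    ∃ (C : Type uA) (_ : CommSemiring C) (ι : C →+* Module.End F ((Fin n → ℕ) →₀ A))
      (a b : Fin n → C), (∀ p, ι (a p) = mapCoeff (d p)) ∧ (∀ p, ι (b p) = shift p) := by
  classical
  let s : Set (Module.End F ((Fin n → ℕ) →₀ A)) :=
    Set.range (fun p => mapCoeff (d p)) ∪ Set.range (fun p => shift p)
  have hDX : ∀ p q, mapCoeff (d p) * shift (F := F) q = shift q * mapCoeff (n := n) (d p) := by
    intro p q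
    refine Finsupp.lhom_ext fun ν v => ?_
    simp [mapCoeff_single, shift_single]
  have hs : ∀ a ∈ s, ∀ b ∈ s, a * b = b * a := by
    rintro _ (⟨p, rfl⟩ | ⟨p, rfl⟩) _ (⟨q, rfl⟩ | ⟨q, rfl⟩)
    · simp only [← map_mul, hd]
    · exact hDX p q
    · exact (hDX q p).symm
    · refine Finsupp.lhom_ext fun ν v => ?_
      simp [shift_single, add_left_comm]
  have hC := Algebra.isMulCommutative_adjoin F hs
  let _ : CommSemiring (Algebra.adjoin F s) :=
    { (Algebra.adjoin F s).toSemiring with mul_comm := fun x y => hC.is_comm.comm x y }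
  refine ⟨Algebra.adjoin F s, inferInstance, (Algebra.adjoin F s).val.toRingHom,
    fun p => ⟨mapCoeff (d p), Algebra.subset_adjoin (Or.inl ⟨p, rfl⟩)⟩,
    fun p => ⟨shift p, Algebra.subset_adjoin (Or.inr ⟨p, rfl⟩)⟩, fun p => rfl, fun p => rfl⟩

/-- Left multiplication by `∂_p`. -/
def lop (d : Fin n → Module.End F A) (p : Fin n) : Module.End F ((Fin n → ℕ) →₀ A) :=
  mapCoeff (d p) + shift p

def lpow (d : Fin n → Module.End F A) (μ : Fin n → ℕ) : Module.End F ((Fin n → ℕ) →₀ A) :=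
  (List.ofFn fun p => lop d p ^ μ p).prod

theorem lpow_single (d : Fin n → Module.End F A) (hd : ∀ p q, d p * d q = d q * d p)
    (μ ν : Fin n → ℕ) (v : A) : lpow d μ (Finsupp.single ν v) =
      ∑ κ ∈ Fintype.piFinset (fun p => Finset.range (μ p + 1)),
        Finsupp.single (μ + ν - κ) ((∏ p, (μ p).choose (κ p)) • dpow d κ v) := by
  classical
  obtain ⟨C, _, ι, a, b, ha, hb⟩ := exists_comm d hd
  have hl : lpow d μ = ι (∏ p, (a p + b p) ^ μ p) := by
    rw [← List.prod_ofFn, map_list_prod, lpow, List.map_ofFn]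
    congr 2
    funext p
    simp [lop, ha, hb]
  have hA : ∀ κ : Fin n → ℕ, ι (∏ p, a p ^ κ p) = mapCoeff (dpow d κ) := by
    intro κ
    rw [← List.prod_ofFn, map_list_prod, dpow, map_list_prod, List.map_ofFn, List.map_ofFn]
    congr 2
    funext p
    simp [ha]
  have hbk : ∀ (p : Fin n) (k : ℕ) (ρ : Fin n → ℕ),
      ι (b p ^ k) (Finsupp.single ρ v) = Finsupp.single (Pi.single p k + ρ) v := by
    intro p k
    induction k with
    | zero => intro ρ; simp
    | succ k ih =>
      intro ρ
      rw [pow_succ, map_mul, Module.End.mul_apply, hb, shift_single, ih, ← add_assoc,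
        ← Pi.single_add]
  have hB : ∀ (κ : Fin n → ℕ) (s : Finset (Fin n)), ι (∏ p ∈ s, b p ^ κ p) (Finsupp.single ν v)
      = Finsupp.single ((∑ p ∈ s, Pi.single p (κ p)) + ν) v := by
    intro κ s
    induction s using Finset.induction_on with
    | empty => simp
    | insert p s hp ih =>
      rw [Finset.prod_insert hp, map_mul, Module.End.mul_apply, ih, hbk, Finset.sum_insert hp,
        add_assoc]
  rw [hl]
  simp_rw [add_pow]
  rw [Finset.prod_univ_sum, map_sum, LinearMap.sum_apply]
  refine Finset.sum_congr rfl fun κ hκ => ?_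
  have hle : ∀ p, κ p ≤ μ p := fun p => by
    have := Fintype.mem_piFinset.1 hκ p
    simp at this
    omega
  rw [Finset.prod_mul_distrib, Finset.prod_mul_distrib, ← Nat.cast_prod, mul_comm, ← nsmul_eq_mul,
    map_nsmul, map_mul, LinearMap.smul_apply, Module.End.mul_apply, hB, hA, mapCoeff_single,
    Finsupp.smul_single]
  congr 1
  funext p
  have := hle p
  simp only [Pi.add_apply, Pi.sub_apply, Finset.sum_apply, Pi.single_apply,
    Finset.sum_ite_eq, Finset.mem_univ, if_true]
  omega

theorem lpow_add (d : Fin n → Module.End F A) (hd : ∀ p q, d p * d q = d q * d p)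
    (p : Fin n) (μ : Fin n → ℕ) : lpow d (Pi.single p 1 + μ) = lop d p * lpow d μ := by
  classical
  obtain ⟨C, _, ι, a, b, ha, hb⟩ := exists_comm d hd
  have hl : ∀ μ, lpow d μ = ι (∏ p, (a p + b p) ^ μ p) := by
    intro μ
    rw [← List.prod_ofFn, map_list_prod, lpow, List.map_ofFn]
    congr 2
    funext p
    simp [lop, ha, hb]
  have h1 : lop d p = ι (a p + b p) := by simp [lop, ha, hb]
  rw [hl, hl, h1, ← map_mul]
  congr 1
  simp only [Pi.add_apply, pow_add, Finset.prod_mul_distrib]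
  congr 1
  rw [Finset.prod_eq_single p] <;> simp +contextual

/-- Left multiplication by an element of `A`. -/
def lcoeff : A →ₗ[F] Module.End F ((Fin n → ℕ) →₀ A) :=
  LinearMap.mk₂ F (fun a P => a • P) (fun _ _ _ => add_smul _ _ _) (fun _ _ _ => smul_assoc _ _ _)
    (fun _ _ _ => smul_add _ _ _) (fun c a P => (smul_comm a c P))

theorem lcoeff_apply (a : A) (P : (Fin n → ℕ) →₀ A) : lcoeff (F := F) a P = a • P := rfl

/-- Left multiplication by `P`. -/
def lmul (d : Fin n → Module.End F A) :
    ((Fin n → ℕ) →₀ A) →ₗ[F] Module.End F ((Fin n → ℕ) →₀ A) :=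
  Finsupp.lsum F fun μ => (LinearMap.mulRight F (lpow d μ)).comp lcoeff

theorem lmul_single (d : Fin n → Module.End F A) (μ : Fin n → ℕ) (u : A) :
    lmul d (Finsupp.single μ u) = lcoeff u * lpow d μ := by
  simp [lmul]

theorem weylMul_eq (d : Fin n → Module.End F A) (hd : ∀ p q, d p * d q = d q * d p)
    (P Q : (Fin n → ℕ) →₀ A) : weylMul d P Q = lmul d P Q := by
  have h : ∀ μ u, lmul d (Finsupp.single μ u) Q = Q.sum fun ν v =>
    ∑ κ ∈ Fintype.piFinset (fun p => Finset.range (μ p + 1)),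
      Finsupp.single (μ + ν - κ) ((∏ p, (μ p).choose (κ p)) • (u * dpow d κ v)) := by
    intro μ u
    conv_lhs => rw [← Finsupp.sum_single Q]
    rw [Finsupp.sum, map_sum, Finsupp.sum]
    refine Finset.sum_congr rfl fun ν _ => ?_
    rw [lmul_single, Module.End.mul_apply, lpow_single d hd, map_sum]
    refine Finset.sum_congr rfl fun κ _ => ?_
    rw [lcoeff_apply, Finsupp.smul_single, smul_eq_mul, mul_smul_comm]
  conv_rhs => rw [← Finsupp.sum_single P]
  rw [Finsupp.sum, map_sum, LinearMap.sum_apply, weylMul, Finsupp.sum]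
  exact Finset.sum_congr rfl fun μ _ => (h _ _).symm

theorem lmul_lmul (d : Fin n → Module.End F A) (hd : ∀ p q, d p * d q = d q * d p)
    (hl : ∀ p u v, d p (u * v) = u * d p v + v * d p u)
    (P Q : (Fin n → ℕ) →₀ A) : lmul d (lmul d P Q) = lmul d P * lmul d Q := by
  let S : Submonoid (Module.End F ((Fin n → ℕ) →₀ A)) :=
    { carrier := {T | ∀ Q, lmul d (T Q) = T * lmul d Q}
      one_mem' := fun Q => by simp
      mul_mem' := fun {T U} hT hU Q => by rw [Module.End.mul_apply, hT, hU, mul_assoc] }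
  have hcoeff : ∀ u : A, lcoeff u ∈ S := by
    intro u Q
    induction Q using Finsupp.induction_linear with
    | zero => simp
    | add P Q hP hQ => simp only [map_add, hP, hQ, mul_add]
    | single ν v =>
      rw [lcoeff_apply, Finsupp.smul_single, lmul_single, lmul_single, ← mul_assoc]
      congr 1
      refine LinearMap.ext fun R => ?_
      rw [Module.End.mul_apply, lcoeff_apply, lcoeff_apply, lcoeff_apply, smul_smul, smul_eq_mul]
  have hlop : ∀ p, lop d p ∈ S := by
    intro p Q
    induction Q using Finsupp.induction_linear with
    | zero => simp
    | add P Q hP hQ => simp only [map_add, hP, hQ, mul_add]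
    | single ν v =>
      have hc : lop d p * lcoeff v = lcoeff v * lop d p + lcoeff (n := n) (d p v) := by
        refine Finsupp.lhom_ext fun ρ w => ?_
        simp only [lop, Module.End.mul_apply, LinearMap.add_apply, lcoeff_apply,
          Finsupp.smul_single, smul_eq_mul, mapCoeff_single, shift_single, smul_add, hl,
          Finsupp.single_add, mul_comm w]
        abel
      rw [lmul_single, ← mul_assoc, hc, lop, LinearMap.add_apply, mapCoeff_single, shift_single,
        map_add, lmul_single, lmul_single, lpow_add d hd, add_mul, ← lop, mul_assoc, add_comm]
  have hlpow : ∀ μ, lpow d μ ∈ S := fun μ => by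
    refine list_prod_mem fun T hT => ?_
    obtain ⟨p, rfl⟩ := (List.mem_ofFn' _ _).1 hT
    exact pow_mem (hlop p) _
  induction P using Finsupp.induction_linear with
  | zero => simp
  | add P P' hP hP' => simp only [map_add, LinearMap.add_apply, hP, hP', add_mul]
  | single μ u =>
    rw [lmul_single]
    exact mul_mem (hcoeff u) (hlpow μ) Q

theorem lpow_one (d : Fin n → Module.End F A) (h1 : ∀ p, d p 1 = 0)
    (hd : ∀ p q, d p * d q = d q * d p) (k : ℕ) : ∀ μ : Fin n → ℕ, ∑ p, μ p = k →
    lpow d μ (Finsupp.single 0 1) = Finsupp.single μ 1 := by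
  induction k with
  | zero =>
    intro μ h
    have : μ = 0 := funext fun p => by simpa using Finset.sum_eq_zero_iff.1 h p (Finset.mem_univ p)
    subst this
    have h0 : lpow d (0 : Fin n → ℕ) = 1 := by
      rw [lpow]
      refine List.prod_eq_one fun T hT => ?_
      obtain ⟨p, rfl⟩ := (List.mem_ofFn' _ _).1 hT
      simp
    simp [h0]
  | succ k ih =>
    intro μ h
    obtain ⟨p, hp⟩ : ∃ p, μ p ≠ 0 := by
      by_contra! hc
      simp [hc] at h
    have hμ : Pi.single p 1 + (μ - Pi.single p 1) = μ := by
      funext q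
      by_cases hq : q = p
      · subst hq
        simp
        omega
      · simp [hq]
    have hsum : ∑ q, (μ - Pi.single p 1 : Fin n → ℕ) q = k := by
      rw [← hμ] at h
      simp only [Pi.add_apply, Finset.sum_add_distrib, Finset.sum_pi_single', Finset.mem_univ,
        if_true] at h
      omega
    conv_lhs => rw [← hμ]
    rw [lpow_add d hd, Module.End.mul_apply, ih _ hsum, lop, LinearMap.add_apply, mapCoeff_single,
      shift_single, h1, Finsupp.single_zero, zero_add, hμ]

theorem lmul_one (d : Fin n → Module.End F A) (h1 : ∀ p, d p 1 = 0)
    (hd : ∀ p q, d p * d q = d q * d p) (P : (Fin n → ℕ) →₀ A) :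
    lmul d P (Finsupp.single 0 1) = P := by
  induction P using Finsupp.induction_linear with
  | zero => simp
  | add P Q hP hQ => rw [map_add, LinearMap.add_apply, hP, hQ]
  | single μ u =>
    rw [lmul_single, Module.End.mul_apply, lpow_one d h1 hd _ μ rfl, lcoeff_apply,
      Finsupp.smul_single, smul_eq_mul, mul_one]

theorem one_lmul (d : Fin n → Module.End F A) (Q : (Fin n → ℕ) →₀ A) :
    lmul d (Finsupp.single 0 1) Q = Q := by
  have h0 : lpow d (0 : Fin n → ℕ) = 1 := by
    rw [lpow]
    refine List.prod_eq_one fun T hT => ?_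
    obtain ⟨p, rfl⟩ := (List.mem_ofFn' _ _).1 hT
    simp
  rw [lmul_single, h0, mul_one, lcoeff_apply, one_smul]

theorem weylMul_assoc (d : Fin n → Module.End F A) (hd : ∀ p q, d p * d q = d q * d p)
    (hl : ∀ p u v, d p (u * v) = u * d p v + v * d p u) (P Q R : (Fin n → ℕ) →₀ A) :
    weylMul d (weylMul d P Q) R = weylMul d P (weylMul d Q R) := by
  simp only [weylMul_eq d hd, lmul_lmul d hd hl, Module.End.mul_apply]

theorem weylMul_add (d : Fin n → Module.End F A) (hd : ∀ p q, d p * d q = d q * d p)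
    (P Q R : (Fin n → ℕ) →₀ A) : weylMul d P (Q + R) = weylMul d P Q + weylMul d P R := by
  simp only [weylMul_eq d hd, map_add]

theorem add_weylMul (d : Fin n → Module.End F A) (hd : ∀ p q, d p * d q = d q * d p)
    (P Q R : (Fin n → ℕ) →₀ A) : weylMul d (P + Q) R = weylMul d P R + weylMul d Q R := by
  simp only [weylMul_eq d hd, map_add, LinearMap.add_apply]

theorem weylMul_smul (d : Fin n → Module.End F A) (hd : ∀ p q, d p * d q = d q * d p) (c : F)
    (P Q : (Fin n → ℕ) →₀ A) : weylMul d P (c • Q) = c • weylMul d P Q := by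
  simp only [weylMul_eq d hd, map_smul]

theorem smul_weylMul (d : Fin n → Module.End F A) (hd : ∀ p q, d p * d q = d q * d p) (c : F)
    (P Q : (Fin n → ℕ) →₀ A) : weylMul d (c • P) Q = c • weylMul d P Q := by
  simp only [weylMul_eq d hd, map_smul, LinearMap.smul_apply]

theorem weylMul_zero (d : Fin n → Module.End F A) (P : (Fin n → ℕ) →₀ A) :
    weylMul d P 0 = 0 := by
  simp [weylMul]

theorem zero_weylMul (d : Fin n → Module.End F A) (P : (Fin n → ℕ) →₀ A) :
    weylMul d 0 P = 0 := by
  simp [weylMul]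

theorem weylMul_one (d : Fin n → Module.End F A) (h1 : ∀ p, d p 1 = 0)
    (hd : ∀ p q, d p * d q = d q * d p) (P : (Fin n → ℕ) →₀ A) :
    weylMul d P (Finsupp.single 0 1) = P := by
  rw [weylMul_eq d hd, lmul_one d h1 hd]

theorem one_weylMul (d : Fin n → Module.End F A) (hd : ∀ p q, d p * d q = d q * d p)
    (P : (Fin n → ℕ) →₀ A) : weylMul d (Finsupp.single 0 1) P = P := by
  rw [weylMul_eq d hd, one_lmul d]

end Assoc
end Weyl

section Concrete

variable (F : Type*) [Field F] (ℓ₁ ℓ₂ ℓ₃ ℓ₄ : ℕ)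

/-- An additive subgroup of `Fⁿ` is nondegenerate if it contains an `F`-basis of `Fⁿ`. -/
def Nondegenerate {F : Type*} [Field F] {n : ℕ} (G : AddSubgroup (Fin n → F)) : Prop :=
  ∃ b : Module.Basis (Fin n) F (Fin n → F), ∀ k, b k ∈ G

/-- The condition on `Γ ⊆ F^ℓ`, `ℓ = ℓ₁ + ℓ₂ + ℓ₃ + ℓ₄`: the first `ℓ₁` coordinates of its elements
vanish, and `Γ`, read in the remaining `ℓ₂ + ℓ₃ + ℓ₄` coordinates, is nondegenerate. -/
structure IsAdmissible {F : Type*} [Field F] {ℓ₁ ℓ₂ ℓ₃ ℓ₄ : ℕ}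
    (Γ : AddSubgroup (Fin (ℓ₁ + (ℓ₂ + ℓ₃ + ℓ₄)) → F)) : Prop where
  eq_zero : ∀ α ∈ Γ, ∀ p, p.val < ℓ₁ → α p = 0
  nondegenerate : Nondegenerate
    (Γ.map (LinearMap.funLeft F F (Fin.natAdd ℓ₁ : Fin (ℓ₂ + ℓ₃ + ℓ₄) → _)).toAddMonoidHom)

/-- The semigroup `J = ℤ₊^{ℓ₁+ℓ₂} × ℤ^{ℓ₃} × {0}^{ℓ₄}` inside `ℤ^ℓ`. -/
def J : AddSubmonoid (Fin (ℓ₁ + (ℓ₂ + ℓ₃ + ℓ₄)) → ℤ) where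
  carrier := {i | (∀ p, p.val < ℓ₁ + ℓ₂ → 0 ≤ i p) ∧ ∀ p, ℓ₁ + ℓ₂ + ℓ₃ ≤ p.val → i p = 0}
  zero_mem' := by simp
  add_mem' := fun {i j} hi hj =>
    ⟨fun p hp => add_nonneg (hi.1 p hp) (hj.1 p hp), fun p hp => by
      simp [hi.2 p hp, hj.2 p hp]⟩

variable {ℓ₁ ℓ₂ ℓ₃ ℓ₄} {F}
variable (Γ : AddSubgroup (Fin (ℓ₁ + (ℓ₂ + ℓ₃ + ℓ₄)) → F))

/-- The semigroup algebra `A = F[Γ × J]`, with basis `x^{α,i}`. -/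
def A := AddMonoidAlgebra F (Γ × J ℓ₁ ℓ₂ ℓ₃ ℓ₄)

instance : CommRing (A Γ) := inferInstanceAs (CommRing (AddMonoidAlgebra F (Γ × J ℓ₁ ℓ₂ ℓ₃ ℓ₄)))

instance : Algebra F (A Γ) := inferInstanceAs (Algebra F (AddMonoidAlgebra F (Γ × J ℓ₁ ℓ₂ ℓ₃ ℓ₄)))

/-- The basis `{x^{α,i}}` of `A`. -/
def aBasis : Module.Basis (Γ × J ℓ₁ ℓ₂ ℓ₃ ℓ₄) F (A Γ) :=
  Module.Basis.ofRepr (AddMonoidAlgebra.coeffLinearEquiv F)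

variable {Γ}

open Classical in
/-- The element `x^{α,i}` of `A` for `i ∈ ℤ^ℓ`, to be read as `0` if `i ∉ J`. -/
def xpow (α : Γ) (i : Fin (ℓ₁ + (ℓ₂ + ℓ₃ + ℓ₄)) → ℤ) : A Γ :=
  if h : i ∈ J ℓ₁ ℓ₂ ℓ₃ ℓ₄ then aBasis Γ (α, ⟨i, h⟩) else 0

theorem aBasis_apply (y : Γ × J ℓ₁ ℓ₂ ℓ₃ ℓ₄) :
    aBasis Γ y = (AddMonoidAlgebra.single y 1 : AddMonoidAlgebra F (Γ × J ℓ₁ ℓ₂ ℓ₃ ℓ₄)) := rfl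

theorem xpow_coe (α : Γ) (i : J ℓ₁ ℓ₂ ℓ₃ ℓ₄) : xpow α i = aBasis Γ (α, i) := by
  rw [xpow, dif_pos i.2]

/-- The operator `∂_p` on `A`, `∂_p(x^{α,i}) = α_p x^{α,i} + i_p x^{α,i-1_[p]}`. The first term is
the grading operator `∂⁺_p`, it vanishes for `p ≤ ℓ₁` because then `α_p = 0`. The second term is
the down-grading operator `∂⁻_p`, it vanishes for `p > ℓ₁ + ℓ₂ + ℓ₃` because then `i_p = 0`; and
`i - 1_[p] ∈ J` whenever `i_p ≠ 0`. -/
def partialOp (p : Fin (ℓ₁ + (ℓ₂ + ℓ₃ + ℓ₄))) : Module.End F (A Γ) :=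
  (aBasis Γ).constr F fun ⟨α, i⟩ =>
    α.1 p • xpow α i + (i.1 p : F) • xpow α (i.1 - Pi.single p 1)

theorem partialOp_xpow (p : Fin (ℓ₁ + (ℓ₂ + ℓ₃ + ℓ₄))) (α : Γ) {i : Fin (ℓ₁ + (ℓ₂ + ℓ₃ + ℓ₄)) → ℤ}
    (hi : i ∈ J ℓ₁ ℓ₂ ℓ₃ ℓ₄) :
    partialOp p (xpow α i) = α.1 p • xpow α i + (i p : F) • xpow α (i - Pi.single p 1) := by
  conv_lhs => rw [xpow, dif_pos hi]
  rw [partialOp, Module.Basis.constr_basis]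

theorem sub_mem_J {i : Fin (ℓ₁ + (ℓ₂ + ℓ₃ + ℓ₄)) → ℤ} (hi : i ∈ J ℓ₁ ℓ₂ ℓ₃ ℓ₄)
    {p : Fin (ℓ₁ + (ℓ₂ + ℓ₃ + ℓ₄))} (hp : i p ≠ 0) : i - Pi.single p 1 ∈ J ℓ₁ ℓ₂ ℓ₃ ℓ₄ := by
  refine ⟨fun q hq => ?_, fun q hq => ?_⟩
  · have := hi.1 q hq
    by_cases h : q = p
    · subst h
      simp
      omega
    · simpa [h] using this
  · have := hi.2 q hq
    by_cases h : q = p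
    · subst h
      exact absurd this hp
    · simpa [h] using this

theorem xpow_mul (α β : Γ) {i j : Fin (ℓ₁ + (ℓ₂ + ℓ₃ + ℓ₄)) → ℤ} (hi : i ∈ J ℓ₁ ℓ₂ ℓ₃ ℓ₄)
    (hj : j ∈ J ℓ₁ ℓ₂ ℓ₃ ℓ₄) : xpow α i * xpow β j = xpow (α + β) (i + j) := by
  rw [xpow, xpow, xpow, dif_pos hi, dif_pos hj, dif_pos (add_mem hi hj), aBasis_apply, aBasis_apply,
    aBasis_apply]
  refine (AddMonoidAlgebra.single_mul_single _ _ _ _).trans ?_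
  rw [mul_one]
  rfl

theorem A_hom_ext {M : Type*} [AddCommMonoid M] [Module F M] {f g : A Γ →ₗ[F] M}
    (h : ∀ α i, i ∈ J ℓ₁ ℓ₂ ℓ₃ ℓ₄ → f (xpow α i) = g (xpow α i)) : f = g := by
  refine (aBasis Γ).ext fun y => ?_
  have := h y.1 y.2.1 y.2.2
  rwa [xpow_coe] at this

theorem partialOp_comm (p q : Fin (ℓ₁ + (ℓ₂ + ℓ₃ + ℓ₄))) :
    partialOp (Γ := Γ) p * partialOp q = partialOp q * partialOp p := by
  have key : ∀ (p q : Fin (ℓ₁ + (ℓ₂ + ℓ₃ + ℓ₄))) (α : Γ) (i : Fin (ℓ₁ + (ℓ₂ + ℓ₃ + ℓ₄)) → ℤ),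
      i ∈ J ℓ₁ ℓ₂ ℓ₃ ℓ₄ → (i q : F) • partialOp p (xpow α (i - Pi.single q 1)) =
        (i q : F) • (α.1 p • xpow α (i - Pi.single q 1) +
          ((i - Pi.single q 1 : _ → ℤ) p : F) • xpow α (i - Pi.single q 1 - Pi.single p 1)) := by
    intro p q α i hi
    by_cases h : i q = 0
    · simp [h]
    · rw [partialOp_xpow p α (sub_mem_J hi h)]
  refine A_hom_ext fun α i hi => ?_
  rw [Module.End.mul_apply, Module.End.mul_apply, partialOp_xpow p α hi, partialOp_xpow q α hi]
  simp only [map_add, map_smul, key _ _ _ _ hi, partialOp_xpow _ α hi]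
  by_cases h : p = q
  · subst h
    rfl
  · have h' : ¬ q = p := fun e => h e.symm
    simp only [smul_add, smul_smul, Pi.single_apply, Pi.sub_apply, h, h', if_false, sub_zero,
      sub_right_comm i (Pi.single p 1), mul_comm]
    abel

theorem partialOp_mul (p : Fin (ℓ₁ + (ℓ₂ + ℓ₃ + ℓ₄))) (u v : A Γ) :
    partialOp p (u * v) = u * partialOp p v + v * partialOp p u := by
  have key : ∀ (α β : Γ) (i j : Fin (ℓ₁ + (ℓ₂ + ℓ₃ + ℓ₄)) → ℤ), i ∈ J ℓ₁ ℓ₂ ℓ₃ ℓ₄ →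
      j ∈ J ℓ₁ ℓ₂ ℓ₃ ℓ₄ → (j p : F) • (xpow α i * xpow β (j - Pi.single p 1)) =
        (j p : F) • xpow (α + β) (i + j - Pi.single p 1) := by
    intro α β i j hi hj
    by_cases h : j p = 0
    · simp [h]
    · rw [xpow_mul α β hi (sub_mem_J hj h), add_sub_assoc]
  have main : (LinearMap.mul F (A Γ)).compr₂ (partialOp p) =
      (LinearMap.mul F (A Γ)).compl₂ (partialOp p) +
        ((LinearMap.mul F (A Γ)).compl₂ (partialOp p)).flip := by
    refine A_hom_ext fun α i hi => A_hom_ext fun β j hj => ?_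
    simp only [LinearMap.compr₂_apply, LinearMap.add_apply, LinearMap.compl₂_apply,
      LinearMap.flip_apply, LinearMap.mul_apply', xpow_mul _ _ hi hj]
    rw [partialOp_xpow p _ (add_mem hi hj), partialOp_xpow p _ hi, partialOp_xpow p _ hj, mul_add,
      mul_add, mul_smul_comm, mul_smul_comm, mul_smul_comm, mul_smul_comm, key _ _ _ _ hi hj,
      key _ _ _ _ hj hi, xpow_mul _ _ hi hj, xpow_mul _ _ hj hi, add_comm β, add_comm j]
    simp only [AddSubgroup.coe_add, Pi.add_apply, add_smul, Int.cast_add]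
    abel
  simpa using LinearMap.congr_fun (LinearMap.congr_fun main u) v

theorem partialOp_one (p : Fin (ℓ₁ + (ℓ₂ + ℓ₃ + ℓ₄))) : partialOp (Γ := Γ) p 1 = 0 := by
  simpa using partialOp_mul (Γ := Γ) p 1 1

variable (Γ)

/-- The Lie algebra `𝒲(ℓ₁, ℓ₂, ℓ₃, ℓ₄, Γ) = A ⊗ F[∂₁, …, ∂_ℓ]` of generalized differential operators.
An element is the finitely supported function that sends `μ` to the coefficient of `∂^μ` in `A`. -/
def W := (Fin (ℓ₁ + (ℓ₂ + ℓ₃ + ℓ₄)) → ℕ) →₀ A Γ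

instance : AddCommGroup (W Γ) :=
  inferInstanceAs (AddCommGroup ((Fin (ℓ₁ + (ℓ₂ + ℓ₃ + ℓ₄)) → ℕ) →₀ A Γ))

instance : Module F (W Γ) :=
  inferInstanceAs (Module F ((Fin (ℓ₁ + (ℓ₂ + ℓ₃ + ℓ₄)) → ℕ) →₀ A Γ))

instance : Mul (W Γ) := ⟨weylMul partialOp⟩

instance : One (W Γ) :=
  ⟨(Finsupp.single 0 1 : (Fin (ℓ₁ + (ℓ₂ + ℓ₃ + ℓ₄)) → ℕ) →₀ A Γ)⟩

/-- The associative algebra structure on `𝒲`. -/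
instance : Ring (W Γ) :=
  { (inferInstance : AddCommGroup (W Γ)), (inferInstance : Mul (W Γ)),
    (inferInstance : One (W Γ)) with
    left_distrib := weylMul_add partialOp partialOp_comm
    right_distrib := add_weylMul partialOp partialOp_comm
    zero_mul := zero_weylMul partialOp
    mul_zero := weylMul_zero partialOp
    mul_assoc := weylMul_assoc partialOp partialOp_comm partialOp_mul
    one_mul := one_weylMul partialOp partialOp_comm
    mul_one := weylMul_one partialOp partialOp_one partialOp_comm }

/-- The `F`-algebra structure on `𝒲`. -/
instance : Algebra F (W Γ) :=
  Algebra.ofModule (smul_weylMul partialOp partialOp_comm)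
    (fun c P Q => weylMul_smul partialOp partialOp_comm c P Q)

/-- The Lie bracket `⁅a, b⁆ = a ⊙ b - b ⊙ a` on `𝒲`. -/
instance : LieRing (W Γ) := LieRing.ofAssociativeRing

instance : LieAlgebra F (W Γ) := LieAlgebra.ofAssociativeAlgebra

variable {Γ}

/-- The element `x^{α,i}∂^μ` of `𝒲`. -/
def elt (α : Γ) (i : J ℓ₁ ℓ₂ ℓ₃ ℓ₄) (μ : Fin (ℓ₁ + (ℓ₂ + ℓ₃ + ℓ₄)) → ℕ) : W Γ :=
  (Finsupp.single μ (aBasis Γ (α, i)) : (Fin (ℓ₁ + (ℓ₂ + ℓ₃ + ℓ₄)) → ℕ) →₀ A Γ)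

variable (Γ) in
/-- The basis `{x^{α,i}∂^μ}` of `𝒲`. -/
def eltBasis : Module.Basis
    ((Fin (ℓ₁ + (ℓ₂ + ℓ₃ + ℓ₄)) → ℕ) × (Γ × J ℓ₁ ℓ₂ ℓ₃ ℓ₄)) F (W Γ) :=
  Module.Basis.ofRepr
    ((Finsupp.mapRange.linearEquiv (aBasis Γ).repr).trans
      (Finsupp.curryLinearEquiv F).symm)

theorem eltBasis_apply (α : Γ) (i : J ℓ₁ ℓ₂ ℓ₃ ℓ₄) (μ : Fin (ℓ₁ + (ℓ₂ + ℓ₃ + ℓ₄)) → ℕ) :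
    eltBasis Γ (μ, (α, i)) = elt α i μ := by
  rw [Module.Basis.apply_eq_iff]
  show (Finsupp.curryLinearEquiv F).symm (Finsupp.mapRange.linearEquiv
    (aBasis Γ).repr (Finsupp.single μ (aBasis Γ (α, i)))) = _
  simp

/-- The element `x^α [∂_p]_m` of `𝒲`, where `[∂]_m = ∂(∂ - 1)⋯(∂ - m + 1)`. -/
def eltFall (p : Fin (ℓ₁ + (ℓ₂ + ℓ₃ + ℓ₄))) (α : Γ) (m : ℕ) : W Γ :=
  elt α 0 0 * Polynomial.aeval (elt 0 0 (Pi.single p 1) : W Γ) (descPochhammer F m)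

/-- The binomial coefficient `a(a-1)⋯(a-k+1)/k!` for `a ∈ F`. -/
def binom (a : F) (k : ℕ) : F := (∏ t ∈ Finset.range k, (a - t)) / (k.factorial : F)

/-- `a^k/k!` for an integer `k`, with the convention that it is `0` for `k < 0`
(and with `0^0 = 1`). -/
def divPow (a : F) : ℤ → F
  | Int.ofNat k => a ^ k / (k.factorial : F)
  | Int.negSucc _ => 0

open Classical in
/-- The condition that the bilinear form `ψ` on `𝒲` is the form `φ₀` given by
`φ₀(x^α [∂]_m, x^β [∂]_k) = δ_{α+β,0} (-1)^m m! k! (α+m choose m+k+1)`. The elements `x^α [∂]_m` are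
a basis of `𝒲` if `ℓ = ℓ₄ = 1`; then `p` is the only index. -/
def IsPhiZero (p : Fin (ℓ₁ + (ℓ₂ + ℓ₃ + ℓ₄))) (ψ : W Γ →ₗ[F] W Γ →ₗ[F] F) : Prop :=
  ∀ (α β : Γ) (m k : ℕ), ψ (eltFall p α m) (eltFall p β k) =
    if α + β = 0 then
      (-1) ^ m * (m.factorial : F) * (k.factorial : F) * binom (α.1 p + m) (m + k + 1)
    else 0

open Classical in
/-- The bilinear form `φ_γ` on `𝒲`, given by its values on the basis `{x^{α,i}∂^μ}`. It is of
interest if `ℓ = ℓ₃ = 1`; then `p` is the only index. -/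
def phi (p : Fin (ℓ₁ + (ℓ₂ + ℓ₃ + ℓ₄))) (γ : Γ) : W Γ →ₗ[F] W Γ →ₗ[F] F :=
  (eltBasis Γ).constr F fun ⟨μ, α, i⟩ => (eltBasis Γ).constr F fun ⟨ν, β, j⟩ =>
    if α + β = γ then
      (-1) ^ μ p * ((μ p).factorial : F) * ((ν p).factorial : F) *
        ∑ s ∈ Finset.range (μ p + ν p + 2),
          binom (i.1 p : F) s * divPow (α.1 p) ((μ p + ν p + 1 : ℤ) - s) *
            divPow (γ.1 p) ((s : ℤ) - i.1 p - j.1 p - 1)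
    else 0

end Concrete

section Cohomology

variable (F L : Type*) [Field F] [LieRing L] [LieAlgebra F L]

/-- The space `C²(L, F)` of 2-cocycles of `L` with trivial coefficients. -/
def C2 : Submodule F (L →ₗ[F] L →ₗ[F] F) where
  carrier := {ψ | (∀ x y, ψ x y = -ψ y x) ∧
    ∀ x y z, ψ ⁅x, y⁆ z + ψ ⁅y, z⁆ x + ψ ⁅z, x⁆ y = 0}
  zero_mem' := by simp
  add_mem' := by
    rintro ψ χ ⟨h1, h2⟩ ⟨h3, h4⟩
    refine ⟨fun x y => ?_, fun x y z => ?_⟩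
    · rw [LinearMap.add_apply, LinearMap.add_apply, LinearMap.add_apply, LinearMap.add_apply, h1 x,
        h3 x, neg_add]
    · have := congrArg₂ (· + ·) (h2 x y z) (h4 x y z)
      simp only [LinearMap.add_apply, add_zero] at this ⊢
      rw [← this]
      abel
  smul_mem' := by
    rintro c ψ ⟨h1, h2⟩
    refine ⟨fun x y => ?_, fun x y z => ?_⟩
    · simp only [LinearMap.smul_apply]
      rw [h1 x, smul_neg]
    · simp only [LinearMap.smul_apply, ← smul_add, h2, smul_zero]

/-- The map that sends a linear function `f` on `L` to the 2-coboundary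
`ψ_f(x, y) = f([x, y])`. -/
def coboundary : (L →ₗ[F] F) →ₗ[F] C2 F L where
  toFun f := ⟨LinearMap.mk₂ F (fun x y => f ⁅x, y⁆) (by simp) (by simp) (by simp) (by simp),
    fun x y => by simp only [LinearMap.mk₂_apply]; rw [← lie_skew, map_neg],
    fun x y z => by
      simp only [LinearMap.mk₂_apply]
      rw [← map_add, ← map_add, ← lie_skew ⁅x, y⁆, ← lie_skew ⁅y, z⁆, ← lie_skew ⁅z, x⁆, ← neg_add,
        ← neg_add, add_rotate, lie_jacobi, neg_zero, map_zero]⟩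
  map_add' f g := rfl
  map_smul' c f := rfl

/-- The space `B²(L, F)` of 2-coboundaries. -/
def B2 : Submodule F (C2 F L) := LinearMap.range (coboundary F L)

/-- The second cohomology `H²(L, F) = C²(L, F) / B²(L, F)` with trivial coefficients. -/
abbrev H2 := C2 F L ⧸ B2 F L

end Cohomology

end

end GenDiffOp

/-! Everything rests on well-chosen elements u of the commutative subalgebra `A` of 𝒲. Bracketing
with u lowers the order of a differential operator, so ad u is locally nilpotent. If b·∂_p(u) = 1
for some b in `A`, then E = b∂_p satisfies [E, u] = 1, and integration by parts against powers of E
makes ad u surjective (`exists_lie_eq`). For such u, the class of a cocycle ψ is determined by the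
functional ψ(u, ·) on the centralizer C(u) (`mem_B2_of_forall_centralizer`), and coboundaries
contribute nothing to this functional. So H² embeds in the dual of C(u), and the question is which
functionals occur.

Vanishing. If ℓ₁ + ℓ₂ > 0, take u = x^{0,1_[p]} with p ≤ ℓ₁ + ℓ₂. Every w in C(u) is [∂_p, w'] with
w' in C(u), because ∂_p has a right inverse on `A`; the cocycle identity then reduces ψ(u, w) to a
value at the central element 1, which is zero (`mem_B2_of_lt`). If Γ contains two independent
vectors α and β, take u = x^α. Then C(u) = [x^β, C(u)], and ψ(u, ·) vanishes on [C(u), C(u)]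
(`mem_B2_of_minor_ne_zero`).

Upper bound in rank one. Here C(u) is just `A` (`exists_eq_ofA_of_lie_eq_zero`). The cocycle
identity with ∂ leaves only the value ψ(x^α, x^{-α}) when ℓ₄ = 1, and the values ψ(t, x^{γ,-1}) when
ℓ₃ = 1, where t = x^{0,1}. On commuting pairs coboundaries vanish, so nonzero values of φ₀ and φ_γ
there prove independence as well.

The explicit forms are cocycles by descent, without expanding the cocycle identity. The form φ_γ is
changed by the derivation ad t only by a coboundary, and φ₀ is changed by the automorphism ∂ ↦ ∂ + 1
only by a coboundary. Hence the defects from skew symmetry and from the cocycle identity are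
invariant under a surjective, locally nilpotent operator in a sense that forces them to vanish
(`mem_C2_of_derivation`, `mem_C2_of_automorphism`). -/

namespace GenDiffOp

/-! ### Cocycles and locally nilpotent surjective inner derivations -/

section Abstract

attribute [local instance] LieRing.ofAssociativeRing

theorem coboundary_apply {F L : Type*} [Field F] [LieRing L] [LieAlgebra F L] (f : L →ₗ[F] F)
    (x y : L) : (coboundary F L f).1 x y = f ⁅x, y⁆ := rfl

/-- If `ad u` is surjective and locally nilpotent, then a 2-cocycle that vanishes on
`u × C(u)` is a 2-coboundary. -/
theorem mem_B2_of_forall_centralizer {F L : Type*} [Field F] [LieRing L] [LieAlgebra F L] (u : L)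
    (hs : ∀ w : L, ∃ y, ⁅u, y⁆ = w) (hn : ∀ w : L, ∃ n : ℕ, (LieAlgebra.ad F L u ^ n) w = 0)
    (ψ : C2 F L) (h0 : ∀ w, ⁅u, w⁆ = 0 → ψ.1 u w = 0) : ψ ∈ B2 F L := by
  have hsurj : Function.Surjective (LieAlgebra.ad F L u) := hs
  obtain ⟨g, hg⟩ := (LieAlgebra.ad F L u).exists_rightInverse_of_surjective
    (LinearMap.range_eq_top.2 hsurj)
  have hg' : ∀ w, ⁅u, g w⁆ = w := fun w => LinearMap.congr_fun hg w
  refine ⟨(ψ.1 u).comp g, ?_⟩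
  -- The difference of g[u, w] and w lies in C(u); this is the only use of the vanishing hypothesis.
  have hu : ∀ w, ψ.1 u (g ⁅u, w⁆) = ψ.1 u w := fun w => by
    have := h0 (g ⁅u, w⁆ - w) (by rw [lie_sub, hg', sub_self])
    rwa [map_sub, sub_eq_zero] at this
  have hχ : ∃ χ : C2 F L, χ = ψ - coboundary F L ((ψ.1 u).comp g) := ⟨_, rfl⟩
  obtain ⟨χ, hχ⟩ := hχ
  have hχu : ∀ w, χ.1 u w = 0 := fun w => by
    rw [hχ]
    show ψ.1 u w - ψ.1 u (g ⁅u, w⁆) = 0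
    rw [hu, sub_self]
  -- Since χ(u, ·) = 0, the form χ is ad u-invariant: χ(a, [u, y]) = -χ([u, a], y). Writing the
  -- second argument as [u, y] therefore lowers the nilpotency order of the first.
  have main : ∀ (n : ℕ) (a : L), (LieAlgebra.ad F L u ^ n) a = 0 → ∀ w, χ.1 a w = 0 := by
    intro n
    induction n with
    | zero => intro a ha w; simp at ha; simp [ha]
    | succ n ih =>
      intro a ha w
      obtain ⟨y, rfl⟩ := hs w
      have h1 := ih ⁅u, a⁆ (by rwa [pow_succ, Module.End.mul_apply] at ha) y
      have h2 := χ.2.2 u a y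
      rw [h1, χ.2.1 _ u, hχu, ← lie_skew, map_neg, LinearMap.neg_apply, χ.2.1 _ a] at h2
      simpa using h2
  have : χ = 0 := by
    refine Subtype.ext (LinearMap.ext fun a => LinearMap.ext fun w => ?_)
    obtain ⟨n, hn⟩ := hn a
    exact main n a hn w
  rw [this] at hχ
  exact (sub_eq_zero.1 hχ.symm).symm

theorem lie_mul_right {R : Type*} [Ring R] (u v w : R) : ⁅u, v * w⁆ = ⁅u, v⁆ * w + v * ⁅u, w⁆ := by
  simp only [LieRing.of_associative_ring_bracket]
  noncomm_ring

theorem lie_pow_of_lie_eq_one {R : Type*} [Ring R] {u E : R} (h : ⁅E, u⁆ = 1) (k : ℕ) :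
    ⁅u, E ^ (k + 1)⁆ = -((k + 1 : ℕ) • E ^ k) := by
  have h' : ⁅u, E⁆ = -1 := by rw [← h, Ring.lie_def, Ring.lie_def, neg_sub]
  induction k with
  | zero => simp [h']
  | succ k ih =>
    rw [pow_succ, lie_mul_right, ih, h', neg_mul, smul_mul_assoc, ← pow_succ, succ_nsmul _ (k + 1)]
    simp [add_comm]

/-- If `[E, u] = 1` and `ad u` is locally nilpotent on a subalgebra `C ∋ E` that it preserves, then
`ad u` maps `C` onto `C`. -/
theorem exists_lie_eq {F R : Type*} [Field F] [CharZero F] [Ring R] [Algebra F R]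
    (C : Subalgebra F R) {u E : R} (hE : E ∈ C) (h1 : ⁅E, u⁆ = 1) (hu : ∀ w ∈ C, ⁅u, w⁆ ∈ C)
    (hn : ∀ w ∈ C, ∃ n : ℕ, (LieAlgebra.ad F R u ^ n) w = 0) :
    ∀ w ∈ C, ∃ y ∈ C, ⁅u, y⁆ = w := by
  have main : ∀ (n : ℕ), ∀ w ∈ C, (LieAlgebra.ad F R u ^ n) w = 0 →
      ∀ k : ℕ, ∃ y ∈ C, ⁅u, y⁆ = w * E ^ k := by
    intro n
    induction n with
    | zero => intro w _ hw k; simp at hw; exact ⟨0, zero_mem _, by simp [hw]⟩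
    | succ n ih =>
      intro w hwC hw k
      obtain ⟨y, hy, hyu⟩ := ih ⁅u, w⁆ (hu w hwC)
        (by rwa [pow_succ, Module.End.mul_apply] at hw) (k + 1)
      -- Integration by parts: [u, wE^(k+1)] = [u, w]E^(k+1) - (k+1)wE^k, and the first term on the
      -- right is [u, y] by induction. The power k is kept general because it grows as the
      -- nilpotency order drops.
      refine ⟨((k + 1 : ℕ) : F)⁻¹ • (y - w * E ^ (k + 1)),
        C.smul_mem (sub_mem hy (mul_mem hwC (pow_mem hE _))) _, ?_⟩
      have hk : ((k + 1 : ℕ) : F) ≠ 0 := Nat.cast_ne_zero.2 (Nat.succ_ne_zero k)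
      have hsm : ∀ (c : F) (z : R), ⁅u, c • z⁆ = c • ⁅u, z⁆ := fun c z => by
        simp only [Ring.lie_def, mul_smul_comm, smul_mul_assoc, smul_sub]
      rw [hsm, lie_sub, hyu, lie_mul_right, lie_pow_of_lie_eq_one h1, sub_add_cancel_left,
        mul_neg, neg_neg, mul_smul_comm, ← Nat.cast_smul_eq_nsmul F, smul_smul, inv_mul_cancel₀ hk,
        one_smul]
  intro w hw
  obtain ⟨n, hn⟩ := hn w hw
  simpa using main n w hw hn 0

theorem exists_lie_eq_self {F R : Type*} [Field F] [CharZero F] [Ring R] [Algebra F R]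
    {u E : R} (h1 : ⁅E, u⁆ = 1)
    (hn : ∀ w, ∃ n : ℕ, (LieAlgebra.ad F R u ^ n) w = 0) (w : R) :
    ∃ y, ⁅u, y⁆ = w := by
  obtain ⟨y, -, hy⟩ := exists_lie_eq (F := F) ⊤ (u := u) (E := E) trivial h1 (fun _ _ => trivial)
    (fun w _ => hn w) w trivial
  exact ⟨y, hy⟩

/-- A cocycle vanishes on `u × [C(u), C(u)]`. -/
theorem cocycle_lie_eq_zero {F L : Type*} [Field F] [LieRing L] [LieAlgebra F L] (ψ : C2 F L)
    {u y z : L} (hy : ⁅u, y⁆ = 0) (hz : ⁅u, z⁆ = 0) : ψ.1 u ⁅y, z⁆ = 0 := by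
  have h := ψ.2.2 u y z
  rw [hy, ← lie_skew z u, hz] at h
  rw [ψ.2.1]
  simpa using h

/-- A central element of a Lie algebra with a surjective `ad u` lies in the radical of each
cocycle. -/
theorem cocycle_central_eq_zero {F L : Type*} [Field F] [LieRing L] [LieAlgebra F L] (ψ : C2 F L)
    {u z : L} (hs : ∀ w : L, ∃ y, ⁅u, y⁆ = w) (hz : ∀ y : L, ⁅z, y⁆ = 0) (w : L) :
    ψ.1 w z = 0 := by
  obtain ⟨y, rfl⟩ := hs w
  have h := ψ.2.2 u y z
  rw [hz, ← lie_skew y z, hz] at h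
  simpa using h

theorem multiIndex_induction {n : ℕ} {P : (Fin n → ℕ) → Prop} (h0 : P 0)
    (hs : ∀ p μ, P μ → P (Pi.single p 1 + μ)) (μ : Fin n → ℕ) : P μ := by
  induction hk : ∑ p, μ p generalizing μ with
  | zero =>
    have : μ = 0 := funext fun p => by simpa using Finset.sum_eq_zero_iff.1 hk p (Finset.mem_univ p)
    rwa [this]
  | succ k ih =>
    obtain ⟨p, hp⟩ : ∃ p, μ p ≠ 0 := by
      by_contra! hc
      simp [hc] at hk
    have hμ : Pi.single p 1 + (μ - Pi.single p 1) = μ := by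
      funext q
      by_cases hq : q = p
      · subst hq
        simp
        omega
      · simp [hq]
    rw [← hμ] at hk ⊢
    refine hs _ _ (ih _ ?_)
    simp only [Pi.add_apply, Finset.sum_add_distrib, Finset.sum_pi_single', Finset.mem_univ,
      if_true] at hk
    omega

end Abstract

/-! ### Functions and derivations as generators of 𝒲 -/

section Elements

variable {F : Type*} [Field F] {ℓ₁ ℓ₂ ℓ₃ ℓ₄ : ℕ}
  {Γ : AddSubgroup (Fin (ℓ₁ + (ℓ₂ + ℓ₃ + ℓ₄)) → F)}

/-- The element `a∂^μ` of `𝒲`. -/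
noncomputable def mono (μ : Fin (ℓ₁ + (ℓ₂ + ℓ₃ + ℓ₄)) → ℕ) : A Γ →ₗ[F] W Γ :=
  (Finsupp.lsingle μ : A Γ →ₗ[F] ((Fin (ℓ₁ + (ℓ₂ + ℓ₃ + ℓ₄)) → ℕ) →₀ A Γ))

theorem W_induction_mono {P : W Γ → Prop} (h0 : P 0) (hadd : ∀ v w, P v → P w → P (v + w))
    (hm : ∀ μ a, P (mono μ a)) (w : W Γ) : P w :=
  Finsupp.induction_linear (motive := P) w h0 (fun v w => hadd v w) hm

theorem lpow_zero {n : ℕ} {A : Type*} [CommRing A] [Algebra F A] (d : Fin n → Module.End F A) :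
    lpow d (0 : Fin n → ℕ) = 1 := by
  rw [lpow]
  refine List.prod_eq_one fun T hT => ?_
  obtain ⟨p, rfl⟩ := (List.mem_ofFn' _ _).1 hT
  simp

theorem mono_mul (μ : Fin (ℓ₁ + (ℓ₂ + ℓ₃ + ℓ₄)) → ℕ) (a : A Γ) (Q : W Γ) :
    mono μ a * Q = lcoeff (F := F) a (lpow partialOp μ Q) := by
  refine (weylMul_eq partialOp partialOp_comm _ _).trans ?_
  exact (LinearMap.congr_fun (lmul_single partialOp μ a) _).trans rfl

theorem mono_zero_mul (a b : A Γ) (μ : Fin (ℓ₁ + (ℓ₂ + ℓ₃ + ℓ₄)) → ℕ) :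
    mono 0 a * mono μ b = mono μ (a * b) := by
  rw [mono_mul, lpow_zero]
  exact Finsupp.smul_single a μ b

/-- The inclusion of `A` into `𝒲`. -/
noncomputable def ofA : A Γ →ₐ[F] W Γ :=
  AlgHom.ofLinearMap (mono 0) rfl fun a b => (mono_zero_mul a b 0).symm

theorem ofA_apply (a : A Γ) : ofA a = mono 0 a := rfl

theorem ofA_mul_mono (a b : A Γ) (μ : Fin (ℓ₁ + (ℓ₂ + ℓ₃ + ℓ₄)) → ℕ) :
    ofA a * mono μ b = mono μ (a * b) :=
  mono_zero_mul a b μ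

theorem ofA_injective : Function.Injective (ofA : A Γ → W Γ) :=
  Finsupp.single_injective 0

variable (Γ) in
/-- The element `∂_p` of `𝒲`. -/
noncomputable def D (p : Fin (ℓ₁ + (ℓ₂ + ℓ₃ + ℓ₄))) : W Γ := elt 0 0 (Pi.single p 1)

theorem D_eq (p : Fin (ℓ₁ + (ℓ₂ + ℓ₃ + ℓ₄))) : D Γ p = mono (Pi.single p 1) 1 := rfl

theorem D_mul_mono (p : Fin (ℓ₁ + (ℓ₂ + ℓ₃ + ℓ₄))) (μ : Fin (ℓ₁ + (ℓ₂ + ℓ₃ + ℓ₄)) → ℕ) (a : A Γ) :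
    D Γ p * mono μ a = mono μ (partialOp p a) + mono (Pi.single p 1 + μ) a := by
  have h := lpow_add (partialOp (Γ := Γ)) partialOp_comm p 0
  rw [lpow_zero, mul_one, add_zero] at h
  rw [D_eq, mono_mul, h]
  refine (one_smul (A Γ) (_ : (Fin (ℓ₁ + (ℓ₂ + ℓ₃ + ℓ₄)) → ℕ) →₀ A Γ)).trans ?_
  show mapCoeff (partialOp p) (Finsupp.single μ a) + shift p (Finsupp.single μ a) = _
  rw [mapCoeff_single, shift_single]
  rfl

theorem D_mul_mono_one (p : Fin (ℓ₁ + (ℓ₂ + ℓ₃ + ℓ₄))) (μ : Fin (ℓ₁ + (ℓ₂ + ℓ₃ + ℓ₄)) → ℕ) :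
    D Γ p * mono μ 1 = mono (Pi.single p 1 + μ) 1 := by
  rw [D_mul_mono, partialOp_one, map_zero, zero_add]

theorem D_comm (p q : Fin (ℓ₁ + (ℓ₂ + ℓ₃ + ℓ₄))) : D Γ p * D Γ q = D Γ q * D Γ p := by
  rw [D_eq q, D_mul_mono_one, D_eq p, ← D_eq q, D_mul_mono_one, add_comm (Pi.single p 1)]

theorem mono_mul_D (p : Fin (ℓ₁ + (ℓ₂ + ℓ₃ + ℓ₄))) (μ : Fin (ℓ₁ + (ℓ₂ + ℓ₃ + ℓ₄)) → ℕ) (a : A Γ) :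
    mono μ a * D Γ p = mono (Pi.single p 1 + μ) a := by
  have h2 : ∀ μ, D Γ p * mono μ 1 = mono μ 1 * D Γ p := by
    refine multiIndex_induction ?_ fun q μ ih => ?_
    · exact (mul_one (D Γ p)).trans (one_mul (D Γ p)).symm
    · rw [← D_mul_mono_one, ← mul_assoc, D_comm, mul_assoc, ih, mul_assoc]
  have h3 : ∀ μ, mono μ a = ofA a * mono μ 1 := fun μ => by rw [ofA_mul_mono, mul_one]
  rw [h3, mul_assoc, ← h2, D_mul_mono_one, ← h3]

theorem lie_def (v w : W Γ) : ⁅v, w⁆ = v * w - w * v := rfl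

theorem lie_D_ofA (p : Fin (ℓ₁ + (ℓ₂ + ℓ₃ + ℓ₄))) (a : A Γ) :
    ⁅D Γ p, ofA a⁆ = ofA (partialOp p a) := by
  rw [lie_def, ofA_apply, D_mul_mono, mono_mul_D, add_sub_cancel_right]
  rfl

theorem lie_ofA_D (p : Fin (ℓ₁ + (ℓ₂ + ℓ₃ + ℓ₄))) (a : A Γ) :
    ⁅ofA a, D Γ p⁆ = -ofA (partialOp p a) := by
  rw [← lie_skew, lie_D_ofA]

theorem lie_ofA_ofA (a b : A Γ) : ⁅ofA a, ofA b⁆ = (0 : W Γ) := by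
  rw [lie_def, ← map_mul, ← map_mul, mul_comm, sub_self]

theorem W_induction {P : W Γ → Prop} (hadd : ∀ v w, P v → P w → P (v + w))
    (hA : ∀ a, P (ofA a)) (hD : ∀ p w, P w → P (w * D Γ p)) (w : W Γ) : P w := by
  refine W_induction_mono (by simpa using hA 0) hadd (fun μ a => ?_) w
  revert μ
  refine multiIndex_induction (hA a) fun p μ h => ?_
  rw [← mono_mul_D]
  exact hD p _ h

/-- Since [a, w∂_p] = [a, w]∂_p - w·∂_p(a), each factor ∂_p raises the nilpotency order by at most
one, while right multiplication by a function commutes with ad a. -/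
theorem ad_ofA_locally_nilpotent (a : A Γ) (w : W Γ) :
    ∃ n : ℕ, (LieAlgebra.ad F (W Γ) (ofA a) ^ n) w = 0 := by
  have hr : ∀ (b : A Γ) (n : ℕ) (w : W Γ), (LieAlgebra.ad F (W Γ) (ofA a) ^ n) w = 0 →
      (LieAlgebra.ad F (W Γ) (ofA a) ^ n) (w * ofA b) = 0 := by
    intro b n
    induction n with
    | zero => intro w hw; simp at hw; simp [hw]
    | succ n ih =>
      intro w hw
      rw [pow_succ, Module.End.mul_apply] at hw ⊢
      rw [LieAlgebra.ad_apply, lie_mul_right, lie_ofA_ofA, mul_zero, add_zero]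
      exact ih _ hw
  have hD : ∀ p (n : ℕ) (w : W Γ), (LieAlgebra.ad F (W Γ) (ofA a) ^ n) w = 0 →
      (LieAlgebra.ad F (W Γ) (ofA a) ^ (n + 1)) (w * D Γ p) = 0 := by
    intro p n
    induction n with
    | zero => intro w hw; simp at hw; simp [hw]
    | succ n ih =>
      intro w hw
      rw [pow_succ, Module.End.mul_apply, LieAlgebra.ad_apply, lie_mul_right, lie_ofA_D, mul_neg,
        map_add, map_neg, hr _ _ _ hw, neg_zero, add_zero]
      rw [pow_succ, Module.End.mul_apply] at hw
      exact ih _ hw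
  revert w
  refine W_induction ?_ (fun b => ⟨1, by simp [lie_ofA_ofA]⟩) ?_
  · rintro v w ⟨m, hm⟩ ⟨n, hn⟩
    refine ⟨m + n, ?_⟩
    rw [map_add, pow_add, Module.End.mul_apply _ _ w, hn, map_zero, add_zero, ← pow_add,
      add_comm m, pow_add, Module.End.mul_apply, hm, map_zero]
  · rintro p w ⟨n, hn⟩
    exact ⟨n + 1, hD p n w hn⟩

end Elements

/-! ### Vanishing of H² when ℓ₁ + ℓ₂ ≠ 0 or ℓ ≥ 2 -/

section Elements

variable {F : Type*} [Field F] {ℓ₁ ℓ₂ ℓ₃ ℓ₄ : ℕ}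
  {Γ : AddSubgroup (Fin (ℓ₁ + (ℓ₂ + ℓ₃ + ℓ₄)) → F)}

theorem lie_ofA_mul_D (p : Fin (ℓ₁ + (ℓ₂ + ℓ₃ + ℓ₄))) (a b : A Γ) :
    ⁅ofA b * D Γ p, ofA a⁆ = ofA (b * partialOp p a) := by
  rw [← lie_skew, lie_mul_right, lie_ofA_ofA, zero_mul, zero_add, lie_ofA_D, mul_neg, neg_neg,
    map_mul]

theorem exists_lie_ofA_eq [CharZero F] {p : Fin (ℓ₁ + (ℓ₂ + ℓ₃ + ℓ₄))} {a b : A Γ}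
    (h : b * partialOp p a = 1) (w : W Γ) : ∃ y, ⁅ofA a, y⁆ = w :=
  exists_lie_eq_self (F := F) (E := ofA b * D Γ p)
    ((lie_ofA_mul_D p a b).trans (by rw [h, map_one])) (ad_ofA_locally_nilpotent a) w

theorem xpow_zero_zero : xpow (0 : Γ) 0 = 1 :=
  xpow_coe 0 0

theorem partialOp_xpow_zero (p : Fin (ℓ₁ + (ℓ₂ + ℓ₃ + ℓ₄))) (α : Γ) :
    partialOp p (xpow α 0) = α.1 p • xpow α 0 := by
  rw [partialOp_xpow p α (zero_mem _)]
  simp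

theorem xpow_neg_mul (α : Γ) : xpow (-α) 0 * xpow α 0 = 1 := by
  rw [xpow_mul _ _ (zero_mem _) (zero_mem _), neg_add_cancel, add_zero, xpow_zero_zero]

theorem inv_mul_partialOp_xpow {p : Fin (ℓ₁ + (ℓ₂ + ℓ₃ + ℓ₄))} {α : Γ} (h : α.1 p ≠ 0) :
    ((α.1 p)⁻¹ • xpow (-α) 0) * partialOp p (xpow α 0) = 1 := by
  rw [partialOp_xpow_zero, smul_mul_smul_comm, xpow_neg_mul, inv_mul_cancel₀ h, one_smul]

theorem single_mem_J {p : Fin (ℓ₁ + (ℓ₂ + ℓ₃ + ℓ₄))} (hp : p.val < ℓ₁ + ℓ₂ + ℓ₃) :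
    Pi.single p 1 ∈ J ℓ₁ ℓ₂ ℓ₃ ℓ₄ := by
  refine ⟨fun q _ => ?_, fun q hq => ?_⟩
  · by_cases h : q = p
    · subst h; simp
    · simp [h]
  · have h : q ≠ p := by rintro rfl; omega
    simp [h]

theorem partialOp_xpow_single {p : Fin (ℓ₁ + (ℓ₂ + ℓ₃ + ℓ₄))} (hp : p.val < ℓ₁ + ℓ₂ + ℓ₃)
    (q : Fin (ℓ₁ + (ℓ₂ + ℓ₃ + ℓ₄))) :
    partialOp q (xpow (0 : Γ) (Pi.single p 1)) = if q = p then 1 else 0 := by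
  rw [partialOp_xpow q _ (single_mem_J hp)]
  by_cases h : q = p
  · subst h; simp [xpow_zero_zero]
  · simp [h]

theorem lie_xpow_single_D {p : Fin (ℓ₁ + (ℓ₂ + ℓ₃ + ℓ₄))} (hp : p.val < ℓ₁ + ℓ₂ + ℓ₃)
    (q : Fin (ℓ₁ + (ℓ₂ + ℓ₃ + ℓ₄))) :
    ⁅ofA (xpow (0 : Γ) (Pi.single p 1)), D Γ q⁆ = if q = p then -1 else 0 := by
  rw [lie_ofA_D, partialOp_xpow_single hp]
  split_ifs <;> simp

theorem exists_lie_xpow_single_eq [CharZero F] {p : Fin (ℓ₁ + (ℓ₂ + ℓ₃ + ℓ₄))}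
    (hp : p.val < ℓ₁ + ℓ₂ + ℓ₃) (w : W Γ) :
    ∃ y, ⁅ofA (xpow (0 : Γ) (Pi.single p 1)), y⁆ = w :=
  exists_lie_ofA_eq (p := p) (b := 1) (by rw [partialOp_xpow_single hp, if_pos rfl, mul_one]) w

theorem A_induction {P : A Γ → Prop} (hadd : ∀ a b, P a → P b → P (a + b))
    (hsmul : ∀ (c : F) a, P a → P (c • a)) (h : ∀ α i, i ∈ J ℓ₁ ℓ₂ ℓ₃ ℓ₄ → P (xpow α i)) (a : A Γ) :
    P a := by
  have h0 : P 0 := by simpa using hsmul 0 _ (h 0 0 (zero_mem _))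
  let S : Submodule F (A Γ) :=
    { carrier := {a | P a}, add_mem' := fun ha hb => hadd _ _ ha hb, zero_mem' := h0
      smul_mem' := fun c _ ha => hsmul c _ ha }
  have : S = ⊤ := by
    rw [eq_top_iff, ← (aBasis Γ).span_eq, Submodule.span_le]
    rintro _ ⟨y, rfl⟩
    have := h y.1 y.2.1 y.2.2
    rwa [xpow_coe] at this
  exact (this ▸ Submodule.mem_top : a ∈ S)

/-- `∂_p` is surjective on `A` for `p ≤ ℓ₁ + ℓ₂`. -/
theorem partialOp_surjective [CharZero F] {p : Fin (ℓ₁ + (ℓ₂ + ℓ₃ + ℓ₄))} (hp : p.val < ℓ₁ + ℓ₂) :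
    Function.Surjective (partialOp (Γ := Γ) p) := by
  refine A_induction ?_ ?_ ?_
  · rintro _ _ ⟨a, rfl⟩ ⟨b, rfl⟩
    exact ⟨a + b, map_add _ _ _⟩
  · rintro c _ ⟨a, rfl⟩
    exact ⟨c • a, map_smul _ _ _⟩
  · intro α i hi
    -- If α_p = 0, antidifferentiation divides by i_p + 1, nonzero because i_p ≥ 0. If α_p ≠ 0, then
    -- ∂_p is α_p plus a lowering operator, inverted by induction on i_p; the descent stops at 0,
    -- again because i_p ≥ 0.
    by_cases hα : α.1 p = 0
    · have h := partialOp_xpow p α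
        (add_mem hi (single_mem_J (ℓ₃ := ℓ₃) (ℓ₄ := ℓ₄) (p := p) (by omega)))
      have hc : ((i p + 1 : ℤ) : F) ≠ 0 := by
        have := hi.1 p hp
        exact Int.cast_ne_zero.2 (by omega)
      refine ⟨((i p + 1 : ℤ) : F)⁻¹ • xpow α (i + Pi.single p 1), ?_⟩
      rw [map_smul, h, hα, zero_smul, zero_add, Pi.add_apply, Pi.single_eq_same, smul_smul,
        inv_mul_cancel₀ hc, one_smul, add_sub_cancel_right]
    · induction hn : (i p).toNat generalizing i with
      | zero =>
        have h0 : i p = 0 := by have := hi.1 p hp; omega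
        refine ⟨(α.1 p)⁻¹ • xpow α i, ?_⟩
        rw [map_smul, partialOp_xpow p α hi, h0, Int.cast_zero, zero_smul, add_zero, smul_smul,
          inv_mul_cancel₀ hα, one_smul]
      | succ n ih =>
        obtain ⟨a, ha⟩ := ih (i - Pi.single p 1) (sub_mem_J hi (by omega)) (by simp; omega)
        refine ⟨(α.1 p)⁻¹ • (xpow α i - (i p : F) • a), ?_⟩
        rw [map_smul, map_sub, map_smul, ha, partialOp_xpow p α hi, add_sub_cancel_right, smul_smul,
          inv_mul_cancel₀ hα, one_smul]

/-- A linear operator on `A`, applied to the coefficients of the elements of `𝒲`. -/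
noncomputable def coeffMap (g : A Γ →ₗ[F] A Γ) : W Γ →ₗ[F] W Γ :=
  (Finsupp.mapRange.linearMap g :
    ((Fin (ℓ₁ + (ℓ₂ + ℓ₃ + ℓ₄)) → ℕ) →₀ A Γ) →ₗ[F] ((Fin (ℓ₁ + (ℓ₂ + ℓ₃ + ℓ₄)) → ℕ) →₀ A Γ))

theorem coeffMap_mono (g : A Γ →ₗ[F] A Γ) (μ : Fin (ℓ₁ + (ℓ₂ + ℓ₃ + ℓ₄)) → ℕ) (a : A Γ) :
    coeffMap g (mono μ a) = mono μ (g a) :=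
  Finsupp.mapRange_single (hf := map_zero g)

theorem coeffMap_ofA (g : A Γ →ₗ[F] A Γ) (a : A Γ) : coeffMap g (ofA a) = ofA (g a) :=
  coeffMap_mono g 0 a

theorem coeffMap_mul_D (g : A Γ →ₗ[F] A Γ) (p : Fin (ℓ₁ + (ℓ₂ + ℓ₃ + ℓ₄))) (w : W Γ) :
    coeffMap g (w * D Γ p) = coeffMap g w * D Γ p := by
  induction w using W_induction_mono with
  | h0 => simp
  | hadd v w hv hw => rw [add_mul, map_add, map_add, add_mul, hv, hw]
  | hm μ a => rw [mono_mul_D, coeffMap_mono, coeffMap_mono, mono_mul_D]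

theorem lie_D_mul_D (p q : Fin (ℓ₁ + (ℓ₂ + ℓ₃ + ℓ₄))) (w : W Γ) :
    ⁅D Γ p, w * D Γ q⁆ = ⁅D Γ p, w⁆ * D Γ q := by
  rw [lie_mul_right, lie_def (D Γ p) (D Γ q), D_comm, sub_self, mul_zero, add_zero]

theorem lie_D_coeffMap {p : Fin (ℓ₁ + (ℓ₂ + ℓ₃ + ℓ₄))} {g : A Γ →ₗ[F] A Γ}
    (hg : ∀ a, partialOp p (g a) = a) (w : W Γ) : ⁅D Γ p, coeffMap g w⁆ = w := by
  induction w using W_induction with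
  | hadd v w hv hw => rw [map_add, lie_add, hv, hw]
  | hA a => rw [coeffMap_ofA, lie_D_ofA, hg]
  | hD q w hw => rw [coeffMap_mul_D, lie_D_mul_D, hw]

/-- Bracketing with the coordinate function acts as minus the formal derivative in ∂_p and leaves
coefficients alone. Consequently the antiderivative on coefficients preserves its centralizer. -/
theorem lie_xpow_single_coeffMap {p : Fin (ℓ₁ + (ℓ₂ + ℓ₃ + ℓ₄))} (hp : p.val < ℓ₁ + ℓ₂ + ℓ₃)
    (g : A Γ →ₗ[F] A Γ) (w : W Γ) :
    ⁅ofA (xpow (0 : Γ) (Pi.single p 1)), coeffMap g w⁆ =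
      coeffMap g ⁅ofA (xpow (0 : Γ) (Pi.single p 1)), w⁆ := by
  induction w using W_induction with
  | hadd v w hv hw => rw [map_add, lie_add, lie_add, hv, hw, map_add]
  | hA a => rw [coeffMap_ofA, lie_ofA_ofA, lie_ofA_ofA, map_zero]
  | hD q w hw =>
    rw [coeffMap_mul_D, lie_mul_right, lie_mul_right, map_add,
      lie_xpow_single_D hp, hw, coeffMap_mul_D]
    split_ifs <;> simp

theorem cocycle_one_eq_zero (ψ : C2 F (W Γ)) {u : W Γ} (hs : ∀ w : W Γ, ∃ y, ⁅u, y⁆ = w) (w : W Γ) :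
    ψ.1 1 w = 0 := by
  rw [ψ.2.1, neg_eq_zero]
  exact cocycle_central_eq_zero ψ hs (fun y => by rw [lie_def, one_mul, mul_one, sub_self]) _

/-- `H²(𝒲, F) = 0` if `ℓ₁ + ℓ₂ ≠ 0`. -/
theorem mem_B2_of_lt [CharZero F] {p : Fin (ℓ₁ + (ℓ₂ + ℓ₃ + ℓ₄))} (hp : p.val < ℓ₁ + ℓ₂)
    (ψ : C2 F (W Γ)) : ψ ∈ B2 F (W Γ) := by
  have hp' : p.val < ℓ₁ + ℓ₂ + ℓ₃ := by omega
  obtain ⟨g, hg⟩ : ∃ g : A Γ →ₗ[F] A Γ, ∀ a, partialOp p (g a) = a := by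
    obtain ⟨g, hg⟩ := (partialOp (Γ := Γ) p).exists_rightInverse_of_surjective
      (LinearMap.range_eq_top.2 (partialOp_surjective hp))
    exact ⟨g, fun a => LinearMap.congr_fun hg a⟩
  have hs := exists_lie_xpow_single_eq (Γ := Γ) hp'
  refine mem_B2_of_forall_centralizer _ hs (ad_ofA_locally_nilpotent _) ψ fun w hw => ?_
  -- In this identity the antiderivative of w commutes with the coordinate function, and the bracket
  -- of that function with ∂_p is the central element -1. Only the term ψ(w, u) survives.
  have h := ψ.2.2 (ofA (xpow 0 (Pi.single p 1))) (D Γ p) (coeffMap g w)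
  have h1 : ⁅coeffMap g w, ofA (xpow (0 : Γ) (Pi.single p 1))⁆ = 0 := by
    rw [← lie_skew, lie_xpow_single_coeffMap hp', hw, map_zero, neg_zero]
  have h2 : ψ.1 1 (coeffMap g w) = 0 := cocycle_one_eq_zero ψ hs _
  have h3 : ⁅D Γ p, coeffMap g w⁆ = w := lie_D_coeffMap hg w
  have h4 : ⁅ofA (xpow (0 : Γ) (Pi.single p 1)), D Γ p⁆ = -1 := by
    rw [lie_xpow_single_D hp', if_pos rfl]
  rw [h1, h3, h4, map_zero, map_neg, LinearMap.zero_apply, LinearMap.neg_apply, h2, neg_zero,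
    zero_add, add_zero] at h
  rw [ψ.2.1, h, neg_zero]

/-- `H²(𝒲, F) = 0` if `Γ` contains two linearly independent vectors. -/
theorem mem_B2_of_minor_ne_zero [CharZero F] {p q : Fin (ℓ₁ + (ℓ₂ + ℓ₃ + ℓ₄))} {α β : Γ}
    (h : α.1 p * β.1 q - α.1 q * β.1 p ≠ 0) (ψ : C2 F (W Γ)) : ψ ∈ B2 F (W Γ) := by
  have hs : ∀ w : W Γ, ∃ y, ⁅ofA (xpow α 0), y⁆ = w := by
    by_cases hα : α.1 p = 0
    · have hα' : α.1 q ≠ 0 := by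
        intro h'
        simp [hα, h'] at h
      exact exists_lie_ofA_eq (inv_mul_partialOp_xpow hα')
    · exact exists_lie_ofA_eq (inv_mul_partialOp_xpow hα)
  refine mem_B2_of_forall_centralizer _ hs (ad_ofA_locally_nilpotent _) ψ fun w hw => ?_
  have hC : ∀ y : W Γ, y ∈ Subalgebra.centralizer F {ofA (xpow α 0)} ↔
      ⁅ofA (xpow α 0), y⁆ = 0 := fun y => by
    simp [Subalgebra.mem_centralizer_iff, lie_def, sub_eq_zero]
  have hE : ∀ a : A Γ, ⁅ofA ((α.1 p * β.1 q - α.1 q * β.1 p)⁻¹ • α.1 p • xpow (-β) 0) * D Γ q -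
      ofA ((α.1 p * β.1 q - α.1 q * β.1 p)⁻¹ • α.1 q • xpow (-β) 0) * D Γ p, ofA a⁆ =
      ofA ((α.1 p * β.1 q - α.1 q * β.1 p)⁻¹ •
        (xpow (-β) 0 * (α.1 p • partialOp q a - α.1 q • partialOp p a))) := fun a => by
    rw [sub_lie, lie_ofA_mul_D, lie_ofA_mul_D, ← map_sub]
    congr 1
    simp only [smul_mul_assoc, mul_sub, mul_smul_comm, smul_sub]
  -- With d the given minor, E = d⁻¹x^{-β}(α_p∂_q - α_q∂_p). The vector field in parentheses kills
  -- x^α and multiplies x^β by d, so E lies in C(x^α) and [E, x^β] = 1.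
  obtain ⟨y, hy, rfl⟩ := exists_lie_eq (F := F) (Subalgebra.centralizer F {ofA (xpow α 0)})
    (u := ofA (xpow β 0))
    (E := ofA ((α.1 p * β.1 q - α.1 q * β.1 p)⁻¹ • α.1 p • xpow (-β) 0) * D Γ q -
      ofA ((α.1 p * β.1 q - α.1 q * β.1 p)⁻¹ • α.1 q • xpow (-β) 0) * D Γ p)
    (by
      rw [hC, ← lie_skew, hE, partialOp_xpow_zero, partialOp_xpow_zero, smul_smul, smul_smul,
        mul_comm (α.1 q) (α.1 p), sub_self, mul_zero, smul_zero, map_zero, neg_zero])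
    ((hE _).trans (by
      rw [partialOp_xpow_zero, partialOp_xpow_zero, smul_smul, smul_smul, ← sub_smul,
        mul_smul_comm, xpow_neg_mul, smul_smul, inv_mul_cancel₀ h, one_smul, map_one]))
    (fun y hy => by
      rw [hC] at hy ⊢
      have := leibniz_lie (ofA (xpow α 0)) (ofA (xpow β 0)) y
      rw [lie_ofA_ofA, hy, zero_lie, lie_zero, add_zero] at this
      exact this)
    (fun y _ => ad_ofA_locally_nilpotent _ y) w ((hC w).2 hw)
  exact cocycle_lie_eq_zero ψ (lie_ofA_ofA _ _) ((hC y).1 hy)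

theorem IsAdmissible.exists_ne_zero (hΓ : IsAdmissible Γ) (h : 0 < ℓ₂ + ℓ₃ + ℓ₄) :
    ∃ (α : Γ) (p : Fin (ℓ₁ + (ℓ₂ + ℓ₃ + ℓ₄))), α.1 p ≠ 0 := by
  obtain ⟨b, hb⟩ := hΓ.nondegenerate
  obtain ⟨α, hα, hαb⟩ := hb ⟨0, h⟩
  obtain ⟨p, hp⟩ := Function.ne_iff.1 (b.ne_zero ⟨0, h⟩)
  rw [← hαb] at hp
  exact ⟨⟨α, hα⟩, _, hp⟩

theorem IsAdmissible.exists_minor_ne_zero (hΓ : IsAdmissible Γ) (h : 2 ≤ ℓ₂ + ℓ₃ + ℓ₄) :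
    ∃ (α β : Γ) (p q : Fin (ℓ₁ + (ℓ₂ + ℓ₃ + ℓ₄))), α.1 p * β.1 q - α.1 q * β.1 p ≠ 0 := by
  obtain ⟨b, hb⟩ := hΓ.nondegenerate
  obtain ⟨α, hα, hαb⟩ := hb ⟨0, by omega⟩
  obtain ⟨β, hβ, hβb⟩ := hb ⟨1, by omega⟩
  obtain ⟨p, hp⟩ := Function.ne_iff.1 (b.ne_zero ⟨0, by omega⟩)
  by_contra! hc
  -- If all minors vanished, this would be a linear relation between two basis vectors with a
  -- nonzero coefficient at the second.
  suffices h0 : b ⟨1, by omega⟩ p • b ⟨0, by omega⟩ + -b ⟨0, by omega⟩ p • b ⟨1, by omega⟩ = 0 by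
    have := DFunLike.congr_fun (congrArg b.repr h0) ⟨1, by omega⟩
    simp at this
    exact hp this
  funext q
  have := hc ⟨α, hα⟩ ⟨β, hβ⟩ (Fin.natAdd ℓ₁ p) (Fin.natAdd ℓ₁ q)
  simp only [← hαb, ← hβb, Pi.add_apply, Pi.smul_apply, smul_eq_mul, Pi.zero_apply]
  show β (Fin.natAdd ℓ₁ p) * α (Fin.natAdd ℓ₁ q) + -α (Fin.natAdd ℓ₁ p) * β (Fin.natAdd ℓ₁ q) = 0
  linear_combination -this

theorem subsingleton_H2 [CharZero F] (hΓ : IsAdmissible Γ)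
    (h : ℓ₁ + ℓ₂ ≠ 0 ∨ 2 ≤ ℓ₁ + (ℓ₂ + ℓ₃ + ℓ₄)) : Subsingleton (H2 F (W Γ)) := by
  rw [Submodule.Quotient.subsingleton_iff, eq_top_iff]
  intro ψ _
  by_cases h' : ℓ₁ + ℓ₂ = 0
  · obtain ⟨α, β, p, q, hpq⟩ := hΓ.exists_minor_ne_zero (by omega)
    exact mem_B2_of_minor_ne_zero hpq ψ
  · exact mem_B2_of_lt (p := ⟨0, by omega⟩) (Nat.pos_of_ne_zero h') ψ

end Elements

/-! ### Cocycles by descent along a derivation or a unipotent automorphism -/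

section Descent

variable {F L : Type*} [Field F]

/-- Induction on the nilpotency order of the second argument: surjectivity lets the first argument
be written δu, and the hypothesis moves δ to the second. -/
theorem eq_zero_of_descent₂ [AddCommGroup L] [Module F L] {δ : Module.End F L}
    (hs : Function.Surjective δ) (hn : ∀ w, ∃ n : ℕ, (δ ^ n) w = 0) {s : L → L → F}
    (h0 : ∀ u, s u 0 = 0) (H : ∀ v, (∀ u, s u (δ v) = 0) → ∀ u, s (δ u) v = 0) (u v : L) :
    s u v = 0 := by
  obtain ⟨n, hv⟩ := hn v
  induction n generalizing u v with
  | zero =>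
    have : v = 0 := hv
    rw [this, h0]
  | succ n ih =>
    obtain ⟨u, rfl⟩ := hs u
    rw [pow_succ, Module.End.mul_apply] at hv
    exact H v (fun u => ih u _ hv) u

/-- The same argument with two arguments receiving δ, by nested induction on their nilpotency
orders. The mixed premise with δ on both is needed for automorphisms, whose invariance relation has
products of δ's. -/
theorem eq_zero_of_descent₃ [AddCommGroup L] [Module F L] {δ : Module.End F L}
    (hs : Function.Surjective δ) (hn : ∀ w, ∃ n : ℕ, (δ ^ n) w = 0) {j : L → L → L → F}
    (h1 : ∀ u w, j u 0 w = 0) (h2 : ∀ u v, j u v 0 = 0)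
    (H : ∀ v w, (∀ u, j u (δ v) w = 0) → (∀ u, j u v (δ w) = 0) → (∀ u, j u (δ v) (δ w) = 0) →
      ∀ u, j (δ u) v w = 0) (u v w : L) : j u v w = 0 := by
  obtain ⟨m, hv⟩ := hn v
  obtain ⟨n, hw⟩ := hn w
  induction m generalizing u v w n with
  | zero =>
    have : v = 0 := hv
    rw [this, h1]
  | succ m ihm =>
    rw [pow_succ, Module.End.mul_apply] at hv
    induction n generalizing u w with
    | zero =>
      have : w = 0 := hw
      rw [this, h2]
    | succ n ihn =>
      obtain ⟨u, rfl⟩ := hs u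
      have hw' := hw
      rw [pow_succ, Module.End.mul_apply] at hw'
      exact H v w (fun u => ihm u _ w hv (n + 1) hw) (fun u => ihn u _ hw')
        (fun u => ihm u _ _ hv n hw') u

variable [LieRing L] [LieAlgebra F L]

theorem lie_jacobi' (u v w : L) : ⁅w, ⁅u, v⁆⁆ + ⁅u, ⁅v, w⁆⁆ + ⁅v, ⁅w, u⁆⁆ = 0 := by
  have := lie_jacobi u v w
  rw [← this]
  abel

/-- A bilinear form on which a surjective locally nilpotent derivation acts by a coboundary is a
2-cocycle. -/
theorem mem_C2_of_derivation {ι : Module.End F L} (hs : Function.Surjective ι)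
    (hn : ∀ w, ∃ n : ℕ, (ι ^ n) w = 0) (hι : ∀ u v, ι ⁅u, v⁆ = ⁅ι u, v⁆ + ⁅u, ι v⁆)
    (φ : L →ₗ[F] L →ₗ[F] F) (T : L →ₗ[F] F)
    (h : ∀ u v, φ (ι u) v + φ u (ι v) = T ⁅v, u⁆) : φ ∈ C2 F L := by
  refine ⟨fun u v => ?_, ?_⟩
  · refine eq_neg_of_add_eq_zero_left (eq_zero_of_descent₂ hs hn (s := fun u v => φ u v + φ v u)
      (by simp) (fun v hv u => ?_) u v)
    have h1 := h u v
    have h2 := h v u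
    have h3 := hv u
    rw [← lie_skew, map_neg] at h2
    linear_combination h1 + h2 - h3
  -- Summing the hypothesis over the three cyclic brackets gives j(ιu,v,w) + j(u,ιv,w) + j(u,v,ιw)
  -- on the left, where j is the cyclic sum of the cocycle identity, and T of a Jacobi sum on the
  -- right.
  · refine eq_zero_of_descent₃ hs hn (by simp) (by simp) fun v w h1 h2 _ u => ?_
    have h1 := h1 u
    have h2 := h2 u
    have e1 := h ⁅u, v⁆ w
    have e2 := h ⁅v, w⁆ u
    have e3 := h ⁅w, u⁆ v
    have e4 := congrArg T (lie_jacobi' u v w)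
    simp only [hι, map_add, LinearMap.add_apply, map_zero] at e1 e2 e3 e4
    linear_combination e1 + e2 + e3 + e4 - h1 - h2

/-- A bilinear form that a unipotent automorphism `1 + δ`, with `δ` surjective, changes by a
coboundary is a 2-cocycle. -/
theorem mem_C2_of_automorphism {δ : Module.End F L} (hs : Function.Surjective δ)
    (hn : ∀ w, ∃ n : ℕ, (δ ^ n) w = 0) (hδ : ∀ u v, ⁅u, v⁆ + δ ⁅u, v⁆ = ⁅u + δ u, v + δ v⁆)
    (φ : L →ₗ[F] L →ₗ[F] F) (T : L →ₗ[F] F)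
    (h : ∀ u v, φ (u + δ u) (v + δ v) = φ u v + T ⁅v, u⁆) : φ ∈ C2 F L := by
  refine ⟨fun u v => ?_, ?_⟩
  · refine eq_neg_of_add_eq_zero_left (eq_zero_of_descent₂ hs hn (s := fun u v => φ u v + φ v u)
      (by simp) (fun v hv u => ?_) u v)
    have h1 := h u v
    have h2 := h v u
    have h3 := hv u
    have h4 := hv (δ u)
    rw [← lie_skew, map_neg] at h2
    simp only [map_add, LinearMap.add_apply] at h1 h2
    linear_combination h1 + h2 - h3 - h4
  · refine eq_zero_of_descent₃ hs hn (by simp) (by simp) fun v w h1 h2 h3 u => ?_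
    have a1 := h1 u
    have a2 := h2 u
    have a3 := h3 u
    have b1 := h1 (δ u)
    have b2 := h2 (δ u)
    have b3 := h3 (δ u)
    have e1 := h ⁅u, v⁆ w
    have e2 := h ⁅v, w⁆ u
    have e3 := h ⁅w, u⁆ v
    have e4 := congrArg T (lie_jacobi' u v w)
    simp only [hδ, add_lie, lie_add, map_add, LinearMap.add_apply, map_zero] at e1 e2 e3 e4
    linear_combination e1 + e2 + e3 + e4 - a1 - a2 - a3 - b1 - b2 - b3

end Descent

/-! ### The centralizer of a function in rank one -/

section Centralizer

variable {F : Type*} [Field F] {ℓ₁ ℓ₂ ℓ₃ ℓ₄ : ℕ}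
  {Γ : AddSubgroup (Fin (ℓ₁ + (ℓ₂ + ℓ₃ + ℓ₄)) → F)}

instance [CharZero F] : IsAddTorsionFree (A Γ) := IsAddTorsionFree.of_isTorsionFree F (A Γ)

/-- In rank one the centralizer of an element of `A` with invertible derivative is `A`. -/
theorem exists_eq_ofA_of_lie_eq_zero [CharZero F] {p : Fin (ℓ₁ + (ℓ₂ + ℓ₃ + ℓ₄))}
    (hp : ∀ q, q = p) {a b : A Γ} (h : b * partialOp p a = 1) {w : W Γ}
    (hw : ⁅ofA a, w⁆ = 0) : ∃ f, w = ofA f := by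
  obtain ⟨E, hE⟩ : ∃ E : W Γ, E = ofA b * D Γ p := ⟨_, rfl⟩
  have hEa : ⁅E, ofA a⁆ = 1 := by rw [hE, lie_ofA_mul_D, h, map_one]
  have hD : D Γ p = ofA (partialOp p a) * E := by
    rw [hE, ← mul_assoc, ← map_mul, mul_comm, h, map_one, one_mul]
  -- Since ∂_p(a) is invertible, ∂_p can be replaced by E: every element of 𝒲 is a polynomial in E
  -- with coefficients from `A` on the left, and ad a becomes minus the formal derivative. The map
  -- is additive but not multiplicative, since E does not commute with `A`.
  let θ : Polynomial (A Γ) → W Γ := fun P => P.eval₂ (ofA (Γ := Γ) : A Γ →+* W Γ) E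
  have θadd : ∀ P Q, θ (P + Q) = θ P + θ Q := fun P Q => Polynomial.eval₂_add _ _
  have θmon : ∀ k c, θ (Polynomial.monomial k c) = ofA c * E ^ k := fun k c =>
    Polynomial.eval₂_monomial _ _
  have θE : ∀ P, θ P * E = θ (P * Polynomial.X) := fun P =>
    (Polynomial.eval₂_mul_X _ _).symm
  have θA : ∀ c P, ofA c * θ P = θ (Polynomial.C c * P) := fun c P => by
    induction P using Polynomial.induction_on' with
    | add P Q hP hQ => rw [θadd, mul_add, mul_add, θadd, hP, hQ]
    | monomial k d => rw [θmon, Polynomial.C_mul_monomial, θmon, map_mul, mul_assoc]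
  have hEg : ∀ (k : ℕ) (g : A Γ), ∃ P, E ^ k * ofA g = θ P := by
    intro k
    induction k with
    | zero => intro g; exact ⟨Polynomial.monomial 0 g, by rw [θmon]; simp⟩
    | succ k ih =>
      intro g
      obtain ⟨P, hP⟩ := ih g
      obtain ⟨Q, hQ⟩ := ih (b * partialOp p g)
      refine ⟨P * Polynomial.X + Q, ?_⟩
      have h1 : E * ofA g = ofA g * E + ofA (b * partialOp p g) := by
        rw [← lie_ofA_mul_D, ← hE, lie_def]
        abel
      rw [θadd, ← θE, ← hP, ← hQ, pow_succ, mul_assoc, h1, mul_add, mul_assoc]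
  have θg : ∀ g P, ∃ Q, θ P * ofA g = θ Q := fun g P => by
    induction P using Polynomial.induction_on' with
    | add P Q hP hQ =>
      obtain ⟨P', hP⟩ := hP
      obtain ⟨Q', hQ⟩ := hQ
      exact ⟨P' + Q', by rw [θadd, θadd, add_mul, hP, hQ]⟩
    | monomial k c =>
      obtain ⟨P, hP⟩ := hEg k g
      exact ⟨Polynomial.C c * P, by rw [θmon, mul_assoc, hP, θA]⟩
  have θsurj : ∀ w : W Γ, ∃ P, w = θ P := fun w => by
    induction w using W_induction with
    | hadd v w hv hw =>
      obtain ⟨P, rfl⟩ := hv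
      obtain ⟨Q, rfl⟩ := hw
      exact ⟨P + Q, (θadd _ _).symm⟩
    | hA a => exact ⟨Polynomial.monomial 0 a, by rw [θmon]; simp⟩
    | hD q w hw =>
      obtain ⟨P, rfl⟩ := hw
      obtain ⟨Q, hQ⟩ := θg (partialOp p a) P
      exact ⟨Q * Polynomial.X, by rw [hp q, hD, ← mul_assoc, hQ, θE]⟩
  have θder : ∀ P, ⁅ofA a, θ P⁆ = -θ (Polynomial.derivative P) := fun P => by
    induction P using Polynomial.induction_on' with
    | add P Q hP hQ => rw [θadd, lie_add, hP, hQ, map_add, θadd, neg_add]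
    | monomial k c =>
      rw [θmon, lie_mul_right, lie_ofA_ofA, zero_mul, zero_add, Polynomial.derivative_monomial,
        θmon]
      cases k with
      | zero => simp [lie_def]
      | succ k =>
        have := lie_pow_of_lie_eq_one (R := W Γ) hEa k
        refine (congrArg (ofA c * ·) this).trans ?_
        simp [mul_assoc]
  have θC : ∀ P : Polynomial (A Γ), P.natDegree = 0 → θ P = ofA (P.coeff 0) := fun P hP => by
    conv_lhs => rw [Polynomial.eq_C_of_natDegree_eq_zero hP, ← Polynomial.monomial_zero_left, θmon,
      pow_zero, mul_one]
  have θinj₀ : ∀ P, θ P = 0 → P.natDegree = 0 → P = 0 := by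
    intro P hP h0
    rw [θC P h0, map_eq_zero_iff _ ofA_injective] at hP
    rw [Polynomial.eq_C_of_natDegree_eq_zero h0, hP, map_zero]
  -- A relation θ(P) = 0 passes to the derivative of P by applying ad a. Induction on the degree
  -- makes P constant, and `A` embeds in 𝒲.
  have θinj : ∀ (n : ℕ) (P), P.natDegree ≤ n → θ P = 0 → P = 0 := by
    intro n
    induction n with
    | zero => exact fun P hn hP => θinj₀ P hP (Nat.le_zero.1 hn)
    | succ n ih =>
      intro P hn hP
      have h1 := ih (Polynomial.derivative P)
        ((Polynomial.natDegree_derivative_le P).trans (by omega))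
        (by rw [← neg_eq_zero, ← θder, hP, lie_zero])
      exact θinj₀ P hP (Polynomial.derivative_eq_zero.1 h1)
  obtain ⟨P, rfl⟩ := θsurj w
  rw [θder, neg_eq_zero] at hw
  exact ⟨_, θC P (Polynomial.derivative_eq_zero.1 (θinj _ _ le_rfl hw))⟩

end Centralizer
-- Falling factorials and the polynomial model of φ₀
section FallingFactorial

open Polynomial

variable {F : Type*} [Field F]

variable (F) in
/-- The falling factorials, as a polynomial sequence. -/
noncomputable def fallSequence : Polynomial.Sequence F where
  elems' := descPochhammer F
  degree_eq' i := by
    rw [degree_eq_natDegree (monic_descPochhammer F i).ne_zero, descPochhammer_natDegree]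

variable (F) in
/-- The basis of `F[X]` that consists of the falling factorials. -/
noncomputable def fallBasis : Module.Basis ℕ F F[X] :=
  (fallSequence F).basis fun i => by
    have : (fallSequence F i).leadingCoeff = 1 := monic_descPochhammer F i
    rw [this]
    exact isUnit_one

theorem fallBasis_apply (i : ℕ) : fallBasis F i = descPochhammer F i :=
  Polynomial.Sequence.basis_eq_self _ _ i

theorem descPochhammer_succ_comp (n : ℕ) : (descPochhammer F (n + 1)).comp (X + 1) =
    descPochhammer F (n + 1) + ((n + 1 : ℕ) : F) • descPochhammer F n := by
  have h := congrArg (fun P => P.comp (X + 1)) (descPochhammer_succ_comp_X_sub_one (R := F) n)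
  simp only [comp_assoc, sub_comp, smul_eq_mul, mul_comp, add_comp, natCast_comp, X_comp, one_comp,
    add_sub_cancel_right, comp_X] at h
  rw [smul_eq_C_mul, C_eq_natCast, Nat.cast_succ, ← sub_eq_iff_eq_add]
  exact h.symm

/-- At n = 0 the truncated index n - 1 is harmless, since its coefficient is zero. -/
theorem descPochhammer_comp (n : ℕ) : (descPochhammer F n).comp (X + 1) =
    descPochhammer F n + (n : F) • descPochhammer F (n - 1) := by
  cases n with
  | zero => simp
  | succ n => exact descPochhammer_succ_comp n

theorem binom_eq (a : F) (k : ℕ) : binom a k = (descPochhammer F k).eval a / k.factorial := by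
  rw [binom, descPochhammer_eval_eq_prod_range]

theorem binom_add_one [CharZero F] (a : F) (k : ℕ) :
    binom (a + 1) (k + 1) = binom a (k + 1) + binom a k := by
  have h := congrArg (fun P => P.eval a) (descPochhammer_succ_comp (F := F) k)
  simp only [eval_comp, eval_add, eval_X, eval_one, eval_smul, smul_eq_mul] at h
  have h1 : (k.factorial : F) ≠ 0 := Nat.cast_ne_zero.2 k.factorial_ne_zero
  have h2 : ((k + 1 : ℕ) : F) ≠ 0 := Nat.cast_ne_zero.2 k.succ_ne_zero
  rw [binom_eq, binom_eq, binom_eq, h, Nat.factorial_succ, Nat.cast_mul]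
  field_simp

theorem factorial_mul_binom [CharZero F] (a : F) (k : ℕ) :
    (k.factorial : F) * binom a k = (descPochhammer F k).eval a := by
  rw [binom_eq, mul_div_cancel₀]
  exact Nat.cast_ne_zero.2 k.factorial_ne_zero

theorem descPochhammer_eval_neg (a : F) (m : ℕ) : (descPochhammer F m).eval (-a) =
    (-1) ^ m * (descPochhammer F m).eval (a + m - 1) := by
  induction m generalizing a with
  | zero => simp
  | succ m ih =>
    have h1 : (descPochhammer F (m + 1)).eval (-a) = -a * (descPochhammer F m).eval (-(a + 1)) := by
      rw [descPochhammer_succ_left, eval_mul, eval_X, eval_comp]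
      congr 2
      simp
      ring
    rw [h1, ih, descPochhammer_succ_eval]
    have h2 : a + 1 + (m : F) - 1 = a + ((m + 1 : ℕ) : F) - 1 := by push_cast; ring
    rw [h2]
    push_cast
    ring

/-- The bilinear form on `F[X]` with
`([X]_m, [X]_k) ↦ (-1)^m m! k! (a+m choose m+k+1)`. -/
noncomputable def fallForm (a : F) : F[X] →ₗ[F] F[X] →ₗ[F] F :=
  (fallBasis F).constr F fun m => (fallBasis F).constr F fun k =>
    (-1) ^ m * (m.factorial : F) * (k.factorial : F) * binom (a + m) (m + k + 1)

theorem fallForm_apply (a : F) (m k : ℕ) :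
    fallForm a (descPochhammer F m) (descPochhammer F k) =
      (-1) ^ m * (m.factorial : F) * (k.factorial : F) * binom (a + m) (m + k + 1) := by
  rw [← fallBasis_apply, ← fallBasis_apply, fallForm, Module.Basis.constr_basis,
    Module.Basis.constr_basis]

/-- On falling factorials of positive degree the invariance is Pascal's rule. The correction comes
from the pairs with a factor of degree 0, where one of the lowered terms is missing; falling
factorials of positive degree vanish at 0, so evaluations at 0 detect exactly these pairs. -/
theorem fallForm_comp [CharZero F] (a : F) (P Q : F[X]) :
    fallForm a (P.comp (X + 1)) (Q.comp (X + 1)) =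
      fallForm a P Q + (P.eval 0 * Q.eval a - P.eval (-a) * Q.eval 0) := by
  let c : F[X] →ₗ[F] F[X] := (aeval (X + 1 : F[X])).toLinearMap
  have hc : ∀ P : F[X], c P = P.comp (X + 1) := fun P => rfl
  let e : F → F[X] →ₗ[F] F := fun b => (aeval b).toLinearMap
  have he : ∀ b P, e b P = P.eval b := fun b P => by simp [e, aeval_def, eval₂_eq_eval_map]
  have main : (fallForm a).compl₁₂ c c = fallForm a +
      ((LinearMap.mul F F).compl₁₂ (e 0) (e a) - (LinearMap.mul F F).compl₁₂ (e (-a)) (e 0)) := by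
    refine (fallBasis F).ext fun m => (fallBasis F).ext fun k => ?_
    simp only [LinearMap.compl₁₂_apply, LinearMap.add_apply, LinearMap.sub_apply, hc, he,
      LinearMap.mul_apply', fallBasis_apply, descPochhammer_comp, map_add, map_smul,
      LinearMap.smul_apply, fallForm_apply, smul_eq_mul]
    cases m with
    | zero =>
      cases k with
      | zero => simp
      | succ k =>
        have := factorial_mul_binom a (k + 1)
        rw [Nat.factorial_succ, Nat.cast_mul] at this
        rw [descPochhammer_ne_zero_eval_zero F k.succ_ne_zero, ← this]
        simp [mul_assoc]
    | succ m =>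
      have hm : ∀ b : F, b + ((m + 1 : ℕ) : F) = b + m + 1 := fun b => by push_cast; ring
      cases k with
      | zero =>
        have := factorial_mul_binom (a + ((m + 1 : ℕ) : F) - 1) (m + 1)
        rw [Nat.factorial_succ, Nat.cast_mul] at this
        rw [descPochhammer_ne_zero_eval_zero F m.succ_ne_zero, descPochhammer_eval_neg, ← this, hm,
          add_sub_cancel_right]
        simp
        ring
      | succ k =>
        rw [descPochhammer_ne_zero_eval_zero F m.succ_ne_zero,
          descPochhammer_ne_zero_eval_zero F k.succ_ne_zero, hm]
        have h1 := binom_add_one (a + (m : F)) (m + k + 1)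
        have e1 : m + 1 + (k + 1 - 1) + 1 = m + k + 1 + 1 := by omega
        have e2 : m + 1 - 1 + (k + 1) + 1 = m + k + 1 + 1 := by omega
        have e3 : m + 1 - 1 + (k + 1 - 1) + 1 = m + k + 1 := by omega
        rw [e1, e2, e3, h1]
        simp only [Nat.add_sub_cancel, Nat.factorial_succ, Nat.cast_mul]
        ring
  have := LinearMap.congr_fun (LinearMap.congr_fun main P) Q
  simpa only [LinearMap.compl₁₂_apply, LinearMap.add_apply, LinearMap.sub_apply, hc, he,
    LinearMap.mul_apply'] using this

end FallingFactorial

/-! ### Operators x^α P(∂) in rank one -/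

section RankOne

open Polynomial

variable {F : Type*} [Field F] {ℓ₁ ℓ₂ ℓ₃ ℓ₄ : ℕ}
  {Γ : AddSubgroup (Fin (ℓ₁ + (ℓ₂ + ℓ₃ + ℓ₄)) → F)}

/-- The element `x^α P(∂_p)` of `𝒲`, as a linear function of `P`. -/
noncomputable def polElt (p : Fin (ℓ₁ + (ℓ₂ + ℓ₃ + ℓ₄))) (α : Γ) : F[X] →ₗ[F] W Γ :=
  (LinearMap.mulLeft F (ofA (xpow α 0))).comp (aeval (D Γ p)).toLinearMap

theorem polElt_apply (p : Fin (ℓ₁ + (ℓ₂ + ℓ₃ + ℓ₄))) (α : Γ) (P : F[X]) :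
    polElt p α P = ofA (xpow α 0) * aeval (D Γ p) P := rfl

theorem polElt_one (p : Fin (ℓ₁ + (ℓ₂ + ℓ₃ + ℓ₄))) (α : Γ) :
    polElt p α 1 = ofA (xpow α 0) := by
  rw [polElt_apply, map_one, mul_one]

theorem eltFall_eq (p : Fin (ℓ₁ + (ℓ₂ + ℓ₃ + ℓ₄))) (α : Γ) (m : ℕ) :
    eltFall p α m = polElt p α (descPochhammer F m) := by
  rw [polElt_apply]
  have : ofA (xpow α 0) = elt α 0 0 := congrArg ofA (xpow_coe α 0)
  rw [this]
  rfl

/-- Because x^β is an eigenvector of ∂, moving it to the left past P(∂) shifts ∂ by the eigenvalue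
β. -/
theorem polElt_mul (p : Fin (ℓ₁ + (ℓ₂ + ℓ₃ + ℓ₄))) (α β : Γ) (P Q : F[X]) :
    polElt p α P * polElt p β Q = polElt p (α + β) (P.comp (X + C (β.1 p)) * Q) := by
  have h : D Γ p * ofA (xpow β 0) = ofA (xpow β 0) * (D Γ p + algebraMap F (W Γ) (β.1 p)) := by
    have h1 := lie_D_ofA p (xpow β 0)
    rw [partialOp_xpow_zero, lie_def, sub_eq_iff_eq_add] at h1
    rw [h1, mul_add, ← Algebra.commutes, ← Algebra.smul_def, map_smul, add_comm]
  have hP : aeval (D Γ p) P * ofA (xpow β 0) =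
      ofA (xpow β 0) * aeval (D Γ p) (P.comp (X + C (β.1 p))) := by
    rw [aeval_comp, map_add, aeval_X, aeval_C]
    have hs : SemiconjBy (ofA (xpow β 0)) (D Γ p + algebraMap F (W Γ) (β.1 p)) (D Γ p) := h.symm
    induction P using Polynomial.induction_on' with
    | add P Q hP hQ => rw [map_add, map_add, add_mul, mul_add, hP, hQ]
    | monomial n c =>
      rw [aeval_monomial, aeval_monomial, mul_assoc, ← (hs.pow_right n).eq, ← mul_assoc,
        ← mul_assoc, Algebra.commutes]
  rw [polElt_apply, polElt_apply, mul_assoc, ← mul_assoc (aeval (D Γ p) P), hP, polElt_apply,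
    map_mul, ← mul_assoc, ← mul_assoc, ← mul_assoc, ← map_mul,
    xpow_mul _ _ (zero_mem _) (zero_mem _), add_zero]

theorem D_pow (p : Fin (ℓ₁ + (ℓ₂ + ℓ₃ + ℓ₄))) (n : ℕ) : D Γ p ^ n = mono (Pi.single p n) 1 := by
  induction n with
  | zero => simp; rfl
  | succ n ih => rw [pow_succ, ih, mono_mul_D, ← Pi.single_add, add_comm 1 n]

theorem elt_eq_mul_D_pow {p : Fin (ℓ₁ + (ℓ₂ + ℓ₃ + ℓ₄))} (hp : ∀ q, q = p) (α : Γ)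
    (i : J ℓ₁ ℓ₂ ℓ₃ ℓ₄) (μ : Fin (ℓ₁ + (ℓ₂ + ℓ₃ + ℓ₄)) → ℕ) :
    elt α i μ = ofA (xpow α i) * D Γ p ^ μ p := by
  rw [D_pow, ofA_mul_mono, mul_one, xpow_coe]
  have : Pi.single p (μ p) = μ := funext fun q => by rw [hp q, Pi.single_eq_same]
  rw [this]
  rfl

theorem elt_eq_polElt {p : Fin (ℓ₁ + (ℓ₂ + ℓ₃ + ℓ₄))} (hp : ∀ q, q = p)
    (hJ : ∀ i ∈ J ℓ₁ ℓ₂ ℓ₃ ℓ₄, i = 0) (α : Γ) (i : J ℓ₁ ℓ₂ ℓ₃ ℓ₄)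
    (μ : Fin (ℓ₁ + (ℓ₂ + ℓ₃ + ℓ₄)) → ℕ) : elt α i μ = polElt p α (X ^ μ p) := by
  rw [polElt_apply, map_pow, aeval_X, elt_eq_mul_D_pow hp, hJ i.1 i.2]

theorem polElt_induction {p : Fin (ℓ₁ + (ℓ₂ + ℓ₃ + ℓ₄))} (hp : ∀ q, q = p)
    (hJ : ∀ i ∈ J ℓ₁ ℓ₂ ℓ₃ ℓ₄, i = 0) {P : W Γ → Prop} (hadd : ∀ v w, P v → P w → P (v + w))
    (h : ∀ α Q, P (polElt p α Q)) (w : W Γ) : P w := by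
  have htop : ⨆ α : Γ, LinearMap.range (polElt p α) = ⊤ := by
    rw [eq_top_iff, ← (eltBasis Γ).span_eq, Submodule.span_le]
    rintro _ ⟨⟨μ, α, i⟩, rfl⟩
    rw [eltBasis_apply, elt_eq_polElt hp hJ]
    exact Submodule.mem_iSup_of_mem α ⟨_, rfl⟩
  refine Submodule.iSup_induction (motive := P) _ (htop ▸ Submodule.mem_top : w ∈ _) ?_ ?_ hadd
  · rintro α _ ⟨Q, rfl⟩
    exact h α Q
  · simpa using h 0 0

/-- The linear map on `𝒲` with given values on the elements `x^α P(∂)`. -/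
noncomputable def polLift {M : Type*} [AddCommGroup M] [Module F M]
    (p : Fin (ℓ₁ + (ℓ₂ + ℓ₃ + ℓ₄))) (G : Γ → F[X] →ₗ[F] M) : W Γ →ₗ[F] M :=
  (eltBasis Γ).constr F fun y => G y.2.1 (X ^ y.1 p)

theorem polLift_polElt {M : Type*} [AddCommGroup M] [Module F M]
    {p : Fin (ℓ₁ + (ℓ₂ + ℓ₃ + ℓ₄))} (hp : ∀ q, q = p)
    (hJ : ∀ i ∈ J ℓ₁ ℓ₂ ℓ₃ ℓ₄, i = 0) (G : Γ → F[X] →ₗ[F] M) (α : Γ) (P : F[X]) :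
    polLift p G (polElt p α P) = G α P := by
  induction P using Polynomial.induction_on' with
  | add P Q hP hQ => rw [map_add, map_add, map_add, hP, hQ]
  | monomial n c =>
    have h1 : polElt p α (X ^ n) = eltBasis Γ (Pi.single p n, (α, 0)) := by
      rw [eltBasis_apply, elt_eq_polElt hp hJ, Pi.single_eq_same]
    rw [← mul_one c, ← smul_eq_mul, ← smul_monomial, monomial_one_right_eq_X_pow, map_smul,
      map_smul, map_smul, h1, polLift, Module.Basis.constr_basis]
    simp only [Pi.single_eq_same]

end RankOne

/-! ### The case ℓ = ℓ₄ = 1 -/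

section RankOne

open Polynomial

variable {F : Type*} [Field F] {ℓ₁ ℓ₂ ℓ₃ ℓ₄ : ℕ}
  {Γ : AddSubgroup (Fin (ℓ₁ + (ℓ₂ + ℓ₃ + ℓ₄)) → F)}

theorem exists_pow_apply_eq_zero_of_span {L : Type*} [AddCommGroup L] [Module F L]
    {δ : Module.End F L} {S : Set L} (hS : Submodule.span F S = ⊤)
    (h : ∀ s ∈ S, ∃ n : ℕ, (δ ^ n) s = 0) (w : L) : ∃ n : ℕ, (δ ^ n) w = 0 := by
  have hw : w ∈ Submodule.span F S := hS ▸ Submodule.mem_top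
  induction hw using Submodule.span_induction with
  | mem s hs => exact h s hs
  | zero => exact ⟨0, rfl⟩
  | add v w _ _ hv hw =>
    obtain ⟨m, hm⟩ := hv
    obtain ⟨n, hn⟩ := hw
    refine ⟨m + n, ?_⟩
    rw [map_add, pow_add, Module.End.mul_apply _ _ w, hn, map_zero, add_zero, ← pow_add,
      add_comm m, pow_add, Module.End.mul_apply, hm, map_zero]
  | smul c w _ hw =>
    obtain ⟨n, hn⟩ := hw
    exact ⟨n, by rw [map_smul, hn, smul_zero]⟩

theorem span_eltFall {p : Fin (ℓ₁ + (ℓ₂ + ℓ₃ + ℓ₄))} (hp : ∀ q, q = p)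
    (hJ : ∀ i ∈ J ℓ₁ ℓ₂ ℓ₃ ℓ₄, i = 0) :
    Submodule.span F (Set.range fun y : Γ × ℕ => eltFall p y.1 y.2) = ⊤ := by
  rw [eq_top_iff]
  rintro w -
  induction w using polElt_induction hp hJ with
  | hadd v w hv hw => exact add_mem hv hw
  | h α Q =>
    have hQ : Q ∈ Submodule.span F (Set.range (fallBasis F)) :=
      (fallBasis F).span_eq ▸ Submodule.mem_top
    induction hQ using Submodule.span_induction with
    | mem s hs =>
      obtain ⟨m, rfl⟩ := hs
      rw [fallBasis_apply, ← eltFall_eq]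
      exact Submodule.subset_span ⟨(α, m), rfl⟩
    | zero => rw [map_zero]; exact zero_mem _
    | add P Q _ _ hP hQ => rw [map_add]; exact add_mem hP hQ
    | smul c P _ hP => rw [map_smul]; exact Submodule.smul_mem _ _ hP

open Classical in
/-- The bilinear form `φ₀`. -/
noncomputable def phiZero (p : Fin (ℓ₁ + (ℓ₂ + ℓ₃ + ℓ₄))) : W Γ →ₗ[F] W Γ →ₗ[F] F :=
  -- The inner lift extends in the second argument and takes values in functionals of P; the flips
  -- put P back first, so that the outer lift applies.
  polLift p fun α => LinearMap.flip (polLift p fun β =>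
    if α + β = 0 then (fallForm (α.1 p)).flip else 0)

open Classical in
theorem phiZero_polElt {p : Fin (ℓ₁ + (ℓ₂ + ℓ₃ + ℓ₄))} (hp : ∀ q, q = p)
    (hJ : ∀ i ∈ J ℓ₁ ℓ₂ ℓ₃ ℓ₄, i = 0) (α β : Γ) (P Q : F[X]) :
    phiZero p (polElt p α P) (polElt p β Q) =
      if α + β = 0 then fallForm (α.1 p) P Q else 0 := by
  rw [phiZero, polLift_polElt hp hJ, LinearMap.flip_apply, polLift_polElt hp hJ]
  split_ifs <;> rfl

theorem isPhiZero_phiZero {p : Fin (ℓ₁ + (ℓ₂ + ℓ₃ + ℓ₄))} (hp : ∀ q, q = p)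
    (hJ : ∀ i ∈ J ℓ₁ ℓ₂ ℓ₃ ℓ₄, i = 0) : IsPhiZero p (phiZero (Γ := Γ) p) := by
  intro α β m k
  rw [eltFall_eq, eltFall_eq, phiZero_polElt hp hJ, fallForm_apply]

theorem IsPhiZero.eq {p : Fin (ℓ₁ + (ℓ₂ + ℓ₃ + ℓ₄))} (hp : ∀ q, q = p)
    (hJ : ∀ i ∈ J ℓ₁ ℓ₂ ℓ₃ ℓ₄, i = 0) {ψ χ : W Γ →ₗ[F] W Γ →ₗ[F] F} (hψ : IsPhiZero p ψ)
    (hχ : IsPhiZero p χ) : ψ = χ := by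
  refine LinearMap.ext_on (span_eltFall hp hJ) ?_
  rintro _ ⟨⟨α, m⟩, rfl⟩
  refine LinearMap.ext_on (span_eltFall hp hJ) ?_
  rintro _ ⟨⟨β, k⟩, rfl⟩
  exact (hψ α β m k).trans (hχ α β m k).symm

/-- The linear map `x^α P(∂) ↦ x^α (P(∂ + 1) - P(∂))`. -/
noncomputable def polDiff (p : Fin (ℓ₁ + (ℓ₂ + ℓ₃ + ℓ₄))) : Module.End F (W Γ) :=
  polLift p fun α => (polElt p α).comp ((aeval (X + 1 : F[X])).toLinearMap - LinearMap.id)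

theorem polDiff_polElt {p : Fin (ℓ₁ + (ℓ₂ + ℓ₃ + ℓ₄))} (hp : ∀ q, q = p)
    (hJ : ∀ i ∈ J ℓ₁ ℓ₂ ℓ₃ ℓ₄, i = 0) (α : Γ) (P : F[X]) :
    polDiff p (polElt p α P) = polElt p α (P.comp (X + 1)) - polElt p α P := by
  rw [polDiff, polLift_polElt hp hJ, ← map_sub]
  rfl

theorem polElt_add_polDiff {p : Fin (ℓ₁ + (ℓ₂ + ℓ₃ + ℓ₄))} (hp : ∀ q, q = p)
    (hJ : ∀ i ∈ J ℓ₁ ℓ₂ ℓ₃ ℓ₄, i = 0) (α : Γ) (P : F[X]) :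
    polElt p α P + polDiff p (polElt p α P) = polElt p α (P.comp (X + 1)) := by
  rw [polDiff_polElt hp hJ, add_sub_cancel]

/-- The difference operator acts on falling factorials as the derivative acts on powers, which makes
its surjectivity and local nilpotency visible. -/
theorem polDiff_eltFall {p : Fin (ℓ₁ + (ℓ₂ + ℓ₃ + ℓ₄))} (hp : ∀ q, q = p)
    (hJ : ∀ i ∈ J ℓ₁ ℓ₂ ℓ₃ ℓ₄, i = 0) (α : Γ) (m : ℕ) :
    polDiff p (eltFall p α m) = (m : F) • eltFall p α (m - 1) := by
  rw [eltFall_eq, eltFall_eq, polDiff_polElt hp hJ, descPochhammer_comp, map_add,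
    add_sub_cancel_left, map_smul]

theorem polDiff_surjective [CharZero F] {p : Fin (ℓ₁ + (ℓ₂ + ℓ₃ + ℓ₄))} (hp : ∀ q, q = p)
    (hJ : ∀ i ∈ J ℓ₁ ℓ₂ ℓ₃ ℓ₄, i = 0) : Function.Surjective (polDiff (Γ := Γ) p) := by
  rw [← LinearMap.range_eq_top, eq_top_iff, ← span_eltFall hp hJ, Submodule.span_le]
  rintro _ ⟨⟨α, m⟩, rfl⟩
  refine ⟨((m + 1 : ℕ) : F)⁻¹ • eltFall p α (m + 1), ?_⟩
  rw [map_smul, polDiff_eltFall hp hJ, smul_smul,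
    inv_mul_cancel₀ (Nat.cast_ne_zero.2 m.succ_ne_zero), one_smul]
  rfl

theorem polDiff_locally_nilpotent {p : Fin (ℓ₁ + (ℓ₂ + ℓ₃ + ℓ₄))} (hp : ∀ q, q = p)
    (hJ : ∀ i ∈ J ℓ₁ ℓ₂ ℓ₃ ℓ₄, i = 0) (w : W Γ) : ∃ n : ℕ, (polDiff p ^ n) w = 0 := by
  refine exists_pow_apply_eq_zero_of_span (span_eltFall hp hJ) ?_ w
  rintro _ ⟨⟨α, m⟩, rfl⟩
  refine ⟨m + 1, ?_⟩
  induction m with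
  | zero => simp [polDiff_eltFall hp hJ]
  | succ m ih =>
    rw [pow_succ, Module.End.mul_apply, polDiff_eltFall hp hJ, map_smul]
    exact (congrArg _ ih).trans (smul_zero _)

theorem polElt_lie (p : Fin (ℓ₁ + (ℓ₂ + ℓ₃ + ℓ₄))) (α β : Γ) (P Q : F[X]) :
    ⁅polElt p α P, polElt p β Q⁆ =
      polElt p (α + β) (P.comp (X + C (β.1 p)) * Q - Q.comp (X + C (α.1 p)) * P) := by
  rw [lie_def, polElt_mul, polElt_mul, add_comm β, map_sub]

/-- Adding the identity to the difference operator gives the substitution ∂ ↦ ∂ + 1. It respects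
brackets because it commutes with the shifts by elements of Γ in the product rule. -/
theorem polDiff_lie {p : Fin (ℓ₁ + (ℓ₂ + ℓ₃ + ℓ₄))} (hp : ∀ q, q = p)
    (hJ : ∀ i ∈ J ℓ₁ ℓ₂ ℓ₃ ℓ₄, i = 0) (u v : W Γ) :
    ⁅u, v⁆ + polDiff p ⁅u, v⁆ = ⁅u + polDiff p u, v + polDiff p v⁆ := by
  induction u using polElt_induction hp hJ with
  | hadd u u' hu hu' =>
    have h : u + u' + polDiff p (u + u') = (u + polDiff p u) + (u' + polDiff p u') := by
      rw [map_add]; abel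
    rw [h, add_lie, add_lie, ← hu, ← hu', map_add]
    abel
  | h α P =>
    induction v using polElt_induction hp hJ with
    | hadd v v' hv hv' =>
      have h : v + v' + polDiff p (v + v') = (v + polDiff p v) + (v' + polDiff p v') := by
        rw [map_add]; abel
      rw [h, lie_add, lie_add, ← hv, ← hv', map_add]
      abel
    | h β Q =>
      have h : ∀ (R : F[X]) (b : F), (R.comp (X + C b)).comp (X + 1) =
          (R.comp (X + 1)).comp (X + C b) := fun R b => by
        rw [comp_assoc, comp_assoc]
        congr 1
        simp [add_right_comm]
      rw [polElt_lie, polElt_add_polDiff hp hJ, polElt_add_polDiff hp hJ,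
        polElt_add_polDiff hp hJ, polElt_lie, sub_comp, mul_comp, mul_comp, h, h]

open Classical in
theorem phiZero_mem_C2 [CharZero F] {p : Fin (ℓ₁ + (ℓ₂ + ℓ₃ + ℓ₄))} (hp : ∀ q, q = p)
    (hJ : ∀ i ∈ J ℓ₁ ℓ₂ ℓ₃ ℓ₄, i = 0) : phiZero (Γ := Γ) p ∈ C2 F (W Γ) := by
  refine mem_C2_of_automorphism (δ := polDiff (Γ := Γ) p) (polDiff_surjective hp hJ)
    (polDiff_locally_nilpotent hp hJ) (fun u v => polDiff_lie hp hJ u v) (phiZero (Γ := Γ) p)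
    -- The functional x^α P(∂) ↦ δ_{α,0} P(0), applied to a bracket with β = -α, is the correction
    -- term of `fallForm_comp`.
    (polLift p fun α : Γ => if α = 0 then (aeval (0 : F)).toLinearMap else 0) fun u v => ?_
  induction u using polElt_induction hp hJ with
  | hadd u u' hu hu' =>
    have h : u + u' + polDiff p (u + u') = (u + polDiff p u) + (u' + polDiff p u') := by
      rw [map_add]; abel
    rw [h, lie_add, LinearMap.map_add₂, hu, hu', LinearMap.map_add₂, map_add]
    abel
  | h α P =>
    induction v using polElt_induction hp hJ with
    | hadd v v' hv hv' =>
      have h : v + v' + polDiff p (v + v') = (v + polDiff p v) + (v' + polDiff p v') := by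
        rw [map_add]; abel
      rw [h, add_lie, map_add (phiZero p (polElt p α P + polDiff p (polElt p α P))), hv, hv',
        map_add (phiZero p (polElt p α P)), map_add]
      abel
    | h β Q =>
      rw [polElt_add_polDiff hp hJ, polElt_add_polDiff hp hJ, polElt_lie, polLift_polElt hp hJ,
        phiZero_polElt hp hJ, phiZero_polElt hp hJ, add_comm β α]
      by_cases h : α + β = 0
      · have hβ : β.1 p = -α.1 p := by
          rw [eq_neg_of_add_eq_zero_right h]
          rfl
        rw [if_pos h, if_pos h, if_pos h, fallForm_comp, hβ]
        simp [aeval_def, eval₂_eq_eval_map, eval_comp]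
        ring
      · rw [if_neg h, if_neg h, if_neg h, LinearMap.zero_apply, add_zero]

theorem phiZero_xpow [CharZero F] {p : Fin (ℓ₁ + (ℓ₂ + ℓ₃ + ℓ₄))} (hp : ∀ q, q = p)
    (hJ : ∀ i ∈ J ℓ₁ ℓ₂ ℓ₃ ℓ₄, i = 0) (α : Γ) :
    phiZero p (ofA (xpow α 0)) (ofA (xpow (-α) 0)) = α.1 p := by
  have h := fallForm_apply (α.1 p) 0 0
  rw [descPochhammer_zero] at h
  rw [← polElt_one p, ← polElt_one p, phiZero_polElt hp hJ, if_pos (add_neg_cancel α), h]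
  simp [binom]

theorem mem_B2_of_xpow_eq_zero [CharZero F] {p : Fin (ℓ₁ + (ℓ₂ + ℓ₃ + ℓ₄))} (hp : ∀ q, q = p)
    (hJ : ∀ i ∈ J ℓ₁ ℓ₂ ℓ₃ ℓ₄, i = 0) {α : Γ} (hα : α.1 p ≠ 0) (ψ : C2 F (W Γ))
    (hψ : ψ.1 (ofA (xpow α 0)) (ofA (xpow (-α) 0)) = 0) : ψ ∈ B2 F (W Γ) := by
  have h1 := inv_mul_partialOp_xpow hα
  refine mem_B2_of_forall_centralizer (ofA (xpow α 0)) (exists_lie_ofA_eq h1)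
    (ad_ofA_locally_nilpotent _) ψ fun w hw => ?_
  obtain ⟨f, rfl⟩ := exists_eq_ofA_of_lie_eq_zero hp h1 hw
  clear hw
  induction f using A_induction with
  | hadd f g hf hg => rw [map_add, map_add, hf, hg, add_zero]
  | hsmul c f hf => rw [map_smul, map_smul, hf, smul_zero]
  | h β i hi =>
    rw [hJ i hi]
    by_cases hβ : α.1 p + β.1 p = 0
    · have : β = -α := by
        refine Subtype.ext (funext fun q => ?_)
        rw [hp q]
        exact eq_neg_of_add_eq_zero_right hβ
      rw [this, hψ]
    -- The functions commute and are eigenvectors of ∂, so this identity reads (α + β)·ψ(x^α, x^β) =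
    -- 0.
    · have h := ψ.2.2 (ofA (xpow α 0)) (D Γ p) (ofA (xpow β 0))
      rw [lie_ofA_D, lie_D_ofA, lie_ofA_ofA, map_zero, partialOp_xpow_zero, partialOp_xpow_zero,
        map_smul, map_smul, map_smul, map_neg, map_smul, LinearMap.neg_apply, LinearMap.smul_apply,
        LinearMap.smul_apply, ψ.2.1 (ofA (xpow β 0)), LinearMap.zero_apply, add_zero, smul_neg,
        ← neg_add, ← add_smul, neg_eq_zero, smul_eq_mul] at h
      exact (mul_eq_zero.1 h).resolve_left hβ

theorem H2_of_l4 [CharZero F] {p : Fin (ℓ₁ + (ℓ₂ + ℓ₃ + ℓ₄))} (hp : ∀ q, q = p)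
    (hJ : ∀ i ∈ J ℓ₁ ℓ₂ ℓ₃ ℓ₄, i = 0) {α : Γ} (hα : α.1 p ≠ 0) :
    ∃ φ₀ : C2 F (W Γ), IsPhiZero p φ₀.1 ∧
      (∀ ψ : W Γ →ₗ[F] W Γ →ₗ[F] F, IsPhiZero p ψ → ψ = φ₀.1) ∧
      (Submodule.Quotient.mk φ₀ : H2 F (W Γ)) ≠ 0 ∧
      Submodule.span F {(Submodule.Quotient.mk φ₀ : H2 F (W Γ))} = ⊤ := by
  refine ⟨⟨phiZero p, phiZero_mem_C2 hp hJ⟩, isPhiZero_phiZero hp hJ,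
    fun ψ hψ => hψ.eq hp hJ (isPhiZero_phiZero hp hJ), fun h => ?_, ?_⟩
  · obtain ⟨f, hf⟩ := (Submodule.Quotient.mk_eq_zero _).1 h
    have h1 := phiZero_xpow hp hJ α
    have h2 := coboundary_apply f (ofA (xpow α 0)) (ofA (xpow (-α) 0))
    rw [hf, lie_ofA_ofA, map_zero] at h2
    exact hα (h1.symm.trans h2)
  · rw [eq_top_iff]
    rintro ⟨ψ⟩ -
    refine Submodule.mem_span_singleton.2
      -- φ₀ takes the value α at this pair, so the coefficient is chosen to cancel the only
      -- obstruction.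
      ⟨ψ.1 (ofA (xpow α 0)) (ofA (xpow (-α) 0)) * (α.1 p)⁻¹, ?_⟩
    refine ((Submodule.Quotient.eq _).2 ?_).symm
    refine mem_B2_of_xpow_eq_zero hp hJ hα _ ?_
    show ψ.1 (ofA (xpow α 0)) (ofA (xpow (-α) 0)) -
      (ψ.1 (ofA (xpow α 0)) (ofA (xpow (-α) 0)) * (α.1 p)⁻¹) *
        phiZero p (ofA (xpow α 0)) (ofA (xpow (-α) 0)) = 0
    rw [phiZero_xpow hp hJ, inv_mul_cancel_right₀ hα, sub_self]

end RankOne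

/-! ### Divided powers and a two-term recursion -/

section DividedPowers

variable {F : Type*} [Field F]

theorem divPow_rec [CharZero F] (a : F) (k : ℤ) : (k : F) * divPow a k = a * divPow a (k - 1) := by
  obtain hk | rfl | hk := lt_trichotomy k 0
  · obtain ⟨n, rfl⟩ := Int.eq_negSucc_of_lt_zero hk
    have : Int.negSucc n - 1 = Int.negSucc (n + 1) := by omega
    rw [this]
    simp [divPow]
  · have : (0 : ℤ) - 1 = Int.negSucc 0 := rfl
    rw [this]
    simp [divPow]
  · obtain ⟨n, rfl⟩ : ∃ n : ℕ, k = ((n + 1 : ℕ) : ℤ) := ⟨(k - 1).toNat, by omega⟩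
    have h1 : ((n + 1 : ℕ) : ℤ) - 1 = Int.ofNat n := by simp
    have h2 : ((n + 1 : ℕ) : ℤ) = Int.ofNat (n + 1) := rfl
    rw [h1, Int.cast_natCast, h2]
    have h3 : (n.factorial : F) ≠ 0 := Nat.cast_ne_zero.2 n.factorial_ne_zero
    have h4 : ((n + 1 : ℕ) : F) ≠ 0 := Nat.cast_ne_zero.2 n.succ_ne_zero
    simp only [divPow, Nat.factorial_succ, Nat.cast_mul, pow_succ]
    field_simp

theorem divPow_zero (a : F) : divPow a 0 = 1 := by
  have : (0 : ℤ) = Int.ofNat 0 := rfl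
  rw [this]
  simp [divPow]

theorem divPow_neg_one (a : F) : divPow a (-1) = 0 := rfl

theorem binom_succ [CharZero F] (a : F) (k : ℕ) :
    ((k + 1 : ℕ) : F) * binom a (k + 1) = (a - k) * binom a k := by
  have h3 : (k.factorial : F) ≠ 0 := Nat.cast_ne_zero.2 k.factorial_ne_zero
  have h4 : ((k + 1 : ℕ) : F) ≠ 0 := Nat.cast_ne_zero.2 k.succ_ne_zero
  rw [binom, binom, Finset.prod_range_succ, Nat.factorial_succ, Nat.cast_mul]
  field_simp

/-- The relation at k = 0 says nothing about a(-1), so this value has to be supplied. From it the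
recursion determines all lower values, and the higher ones too if c ≠ 0; for c = 0 it kills every
other value directly. -/
theorem eq_zero_of_recursion [CharZero F] {c : F} {a : ℤ → F}
    (h : ∀ k : ℤ, c * a k + k * a (k - 1) = 0) (h1 : a (-1) = 0) (k : ℤ) : a k = 0 := by
  have hneg : ∀ n : ℕ, a (-1 - n) = 0 := by
    intro n
    induction n with
    | zero => simpa using h1
    | succ n ih =>
      have := h (-1 - n)
      rw [ih, mul_zero, zero_add] at this
      have h2 : (-1 - n : ℤ) - 1 = -1 - (n + 1 : ℕ) := by push_cast; ring
      rw [← h2]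
      exact (mul_eq_zero.1 this).resolve_left (Int.cast_ne_zero.2 (by omega))
  by_cases hc : c = 0
  · have h2 := h (k + 1)
    rw [hc, zero_mul, zero_add, add_sub_cancel_right] at h2
    by_cases hk : k = -1
    · rw [hk, h1]
    · exact (mul_eq_zero.1 h2).resolve_left (Int.cast_ne_zero.2 (by omega))
  · have hpos : ∀ n : ℕ, a (n - 1) = 0 := by
      intro n
      induction n with
      | zero => simpa using h1
      | succ n ih =>
        have h2 := h n
        rw [ih, mul_zero, add_zero] at h2
        have h3 : ((n + 1 : ℕ) : ℤ) - 1 = n := by push_cast; ring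
        rw [h3]
        exact (mul_eq_zero.1 h2).resolve_left hc
    obtain hk | hk := lt_or_ge k 0
    · have := hneg (-1 - k).toNat
      rwa [show (-1 - ((-1 - k).toNat : ℤ)) = k by omega] at this
    · have := hpos (k + 1).toNat
      rwa [show (((k + 1).toNat : ℤ) - 1) = k by omega] at this

end DividedPowers

/-! ### Residues and the forms φ_γ -/

section Residue

variable {F : Type*} [Field F] {ℓ₁ ℓ₂ ℓ₃ ℓ₄ : ℕ}
  {Γ : AddSubgroup (Fin (ℓ₁ + (ℓ₂ + ℓ₃ + ℓ₄)) → F)}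

open Classical in
/-- The linear function on `A` that sends `x^{β,i}` to `δ_{β,γ} γ^{-i-1}/(-i-1)!`. -/
noncomputable def residue (p : Fin (ℓ₁ + (ℓ₂ + ℓ₃ + ℓ₄))) (γ : Γ) : A Γ →ₗ[F] F :=
  (aBasis Γ).constr F fun y => if y.1 = γ then divPow (γ.1 p) (-y.2.1 p - 1) else 0

open Classical in
theorem residue_xpow (p : Fin (ℓ₁ + (ℓ₂ + ℓ₃ + ℓ₄))) (γ β : Γ)
    {i : Fin (ℓ₁ + (ℓ₂ + ℓ₃ + ℓ₄)) → ℤ} (hi : i ∈ J ℓ₁ ℓ₂ ℓ₃ ℓ₄) :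
    residue p γ (xpow β i) = if β = γ then divPow (γ.1 p) (-i p - 1) else 0 := by
  rw [xpow, dif_pos hi, residue, Module.Basis.constr_basis]

/-- Reading x^{γ,i} as e^{γt}t^i, the functional takes the coefficient of t⁻¹, and a derivative has
none. Integration by parts follows. -/
theorem residue_partialOp [CharZero F] {p : Fin (ℓ₁ + (ℓ₂ + ℓ₃ + ℓ₄))}
    (hJ : ∀ i, i ∈ J ℓ₁ ℓ₂ ℓ₃ ℓ₄) (γ : Γ) (f : A Γ) : residue p γ (partialOp p f) = 0 := by
  induction f using A_induction with
  | hadd f g hf hg => rw [map_add, map_add, hf, hg, add_zero]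
  | hsmul c f hf => rw [map_smul, map_smul, hf, smul_zero]
  | h α i hi =>
    rw [partialOp_xpow p α hi, map_add, map_smul, map_smul, residue_xpow p γ α (hJ _),
      residue_xpow p γ α (hJ _)]
    split_ifs with h
    · have := divPow_rec (γ.1 p) (-i p)
      rw [h, smul_eq_mul, smul_eq_mul, ← this, Pi.sub_apply, Pi.single_eq_same, Int.cast_neg,
        neg_sub', sub_neg_eq_add, add_sub_cancel_right]
      ring
    · simp

theorem residue_partialOp_pow_mul [CharZero F] {p : Fin (ℓ₁ + (ℓ₂ + ℓ₃ + ℓ₄))}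
    (hJ : ∀ i, i ∈ J ℓ₁ ℓ₂ ℓ₃ ℓ₄) (γ : Γ) (n : ℕ) (f g : A Γ) :
    residue p γ ((partialOp p ^ n) f * g) =
      (-1) ^ n * residue p γ (f * (partialOp p ^ n) g) := by
  induction n generalizing g with
  | zero => simp
  | succ n ih =>
    have h := residue_partialOp (p := p) hJ γ ((partialOp p ^ n) f * g)
    rw [partialOp_mul, map_add, ih (partialOp p g), ← Module.End.mul_apply _ _ f, ← pow_succ',
      ← Module.End.mul_apply _ _ g, ← pow_succ, mul_comm g] at h
    rw [eq_neg_of_add_eq_zero_right h, pow_succ]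
    ring

theorem partialOp_pow_xpow [CharZero F] {p : Fin (ℓ₁ + (ℓ₂ + ℓ₃ + ℓ₄))}
    (hJ : ∀ i, i ∈ J ℓ₁ ℓ₂ ℓ₃ ℓ₄) (α : Γ) (i : Fin (ℓ₁ + (ℓ₂ + ℓ₃ + ℓ₄)) → ℤ) (n : ℕ) :
    (partialOp p ^ n) (xpow α i) =
      (n.factorial : F) • ∑ s ∈ Finset.range (n + 1),
        (binom (i p : F) s * divPow (α.1 p) ((n : ℤ) - s)) • xpow α (i - Pi.single p (s : ℤ)) := by
  induction n with
  | zero =>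
    simp [divPow_zero, binom]
  | succ n ih =>
    rw [pow_succ', Module.End.mul_apply, ih, map_smul, Nat.factorial_succ, Nat.cast_mul, mul_comm,
      mul_smul]
    congr 1
    have h1 : ∀ s : ℕ, (α.1 p) * (binom (i p : F) s * divPow (α.1 p) ((n : ℤ) - s)) +
        (s : F) * (binom (i p : F) s * divPow (α.1 p) ((n + 1 : ℕ) - s : ℤ)) =
        ((n + 1 : ℕ) : F) * (binom (i p : F) s * divPow (α.1 p) ((n + 1 : ℕ) - s : ℤ)) := by
      intro s
      have := divPow_rec (α.1 p) ((n + 1 : ℕ) - s : ℤ)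
      rw [show ((n + 1 : ℕ) - s : ℤ) - 1 = (n : ℤ) - s by push_cast; ring] at this
      push_cast at this ⊢
      linear_combination -binom (i p : F) s * this
    have h2 : ∀ s : ℕ, (binom (i p : F) s * divPow (α.1 p) ((n : ℤ) - s)) *
        (((i - Pi.single p (s : ℤ) : _ → ℤ) p : ℤ) : F) =
        ((s + 1 : ℕ) : F) *
          (binom (i p : F) (s + 1) * divPow (α.1 p) ((n + 1 : ℕ) - (s + 1 : ℕ) : ℤ)) := fun s => by
      have := binom_succ (i p : F) s
      rw [show ((n + 1 : ℕ) - (s + 1 : ℕ) : ℤ) = (n : ℤ) - s by push_cast; ring, ← mul_assoc, this,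
        Pi.sub_apply, Pi.single_eq_same, Int.cast_sub, Int.cast_natCast]
      ring
    have h3 : ∀ s : ℕ, i - Pi.single p (s : ℤ) - Pi.single p 1 =
        i - Pi.single p ((s + 1 : ℕ) : ℤ) :=
      fun s => by
        rw [sub_sub, ← Pi.single_add, Nat.cast_succ]
    have h4 : ∑ s ∈ Finset.range (n + 1), ((α.1 p) * (binom (i p : F) s *
          divPow (α.1 p) ((n : ℤ) - s))) • xpow α (i - Pi.single p (s : ℤ)) =
        ∑ s ∈ Finset.range (n + 1 + 1), ((α.1 p) * (binom (i p : F) s *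
          divPow (α.1 p) ((n : ℤ) - s))) • xpow α (i - Pi.single p (s : ℤ)) := by
      rw [Finset.sum_range_succ _ (n + 1), show (n : ℤ) - (n + 1 : ℕ) = -1 by push_cast; ring,
        divPow_neg_one, mul_zero, mul_zero, zero_smul, add_zero]
    have h5 : ∑ s ∈ Finset.range (n + 1), (((s + 1 : ℕ) : F) * (binom (i p : F) (s + 1) *
          divPow (α.1 p) ((n + 1 : ℕ) - (s + 1 : ℕ) : ℤ))) •
            xpow α (i - Pi.single p ((s + 1 : ℕ) : ℤ)) =
        ∑ s ∈ Finset.range (n + 1 + 1), ((s : F) * (binom (i p : F) s *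
          divPow (α.1 p) ((n + 1 : ℕ) - s : ℤ))) • xpow α (i - Pi.single p (s : ℤ)) := by
      rw [Finset.sum_range_succ' _ (n + 1), Nat.cast_zero, zero_mul, zero_smul, add_zero]
    simp only [map_sum, map_smul, partialOp_xpow p α (hJ _), smul_add, smul_smul, h2, h3]
    rw [Finset.sum_add_distrib, h5]
    simp only [mul_comm _ (α.1 p)]
    rw [h4, ← Finset.sum_add_distrib, Finset.smul_sum]
    exact Finset.sum_congr rfl fun s _ => by rw [← add_smul, h1, smul_smul]

/-- The sum defining φ_γ is the Leibniz expansion of the (m+n+1)-st derivative of e^{αt}t^i, paired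
with g by the residue. This form of φ_γ is the one that can be computed with. -/
theorem phi_elt [CharZero F] {p : Fin (ℓ₁ + (ℓ₂ + ℓ₃ + ℓ₄))} (hp : ∀ q, q = p)
    (hJ : ∀ i, i ∈ J ℓ₁ ℓ₂ ℓ₃ ℓ₄) (γ : Γ) (m n : ℕ) (f g : A Γ) :
    phi p γ (ofA f * D Γ p ^ m) (ofA g * D Γ p ^ n) =
      (-1) ^ m * (m.factorial : F) * (n.factorial : F) / ((m + n + 1).factorial : F) *
        residue p γ ((partialOp p ^ (m + n + 1)) f * g) := by
  induction f using A_induction with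
  | hadd f f' hf hf' =>
    rw [map_add, add_mul, LinearMap.map_add₂, hf, hf', map_add, add_mul, map_add, mul_add]
  | hsmul c f hf =>
    rw [map_smul, smul_mul_assoc, LinearMap.map_smul₂, hf, map_smul, smul_mul_assoc, map_smul,
      smul_eq_mul, smul_eq_mul, mul_left_comm]
  | h α i hi =>
    induction g using A_induction with
    | hadd g g' hg hg' =>
      rw [map_add, add_mul, map_add (phi p γ _), hg, hg', mul_add, map_add, mul_add]
    | hsmul c g hg =>
      rw [map_smul, smul_mul_assoc, map_smul (phi p γ _), hg, mul_smul_comm, map_smul,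
        smul_eq_mul, smul_eq_mul, mul_left_comm]
    | h β j hj =>
      have h1 : ∀ (α : Γ) (i : Fin (ℓ₁ + (ℓ₂ + ℓ₃ + ℓ₄)) → ℤ) (m : ℕ),
          ofA (xpow α i) * D Γ p ^ m = eltBasis Γ (Pi.single p m, (α, ⟨i, hJ i⟩)) :=
        fun α i m => by
          rw [eltBasis_apply, elt_eq_mul_D_pow hp, Pi.single_eq_same]
      have hN : ((m + n + 1).factorial : F) ≠ 0 := Nat.cast_ne_zero.2 (Nat.factorial_ne_zero _)
      rw [h1, h1, phi, Module.Basis.constr_basis, Module.Basis.constr_basis,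
        partialOp_pow_xpow hJ, smul_mul_assoc, map_smul, Finset.sum_mul, map_sum, smul_eq_mul,
        ← mul_assoc, div_mul_cancel₀ _ hN]
      simp only [smul_mul_assoc, map_smul, smul_eq_mul, xpow_mul _ _ (hJ _) hj,
        residue_xpow p γ _ (hJ _), Pi.single_eq_same]
      split_ifs with h
      · congr 1
        refine Finset.sum_congr rfl fun s _ => ?_
        congr 2
        simp only [Pi.add_apply, Pi.sub_apply, Pi.single_eq_same]
        ring
      · simp

theorem W_induction_pow {p : Fin (ℓ₁ + (ℓ₂ + ℓ₃ + ℓ₄))} (hp : ∀ q, q = p) {P : W Γ → Prop}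
    (hadd : ∀ v w, P v → P w → P (v + w)) (h : ∀ f m, P (ofA f * D Γ p ^ m)) (w : W Γ) : P w := by
  refine W_induction_mono (by simpa using h 0 0) hadd (fun μ a => ?_) w
  have := h a (μ p)
  rw [D_pow, ofA_mul_mono, mul_one] at this
  rwa [show Pi.single p (μ p) = μ from funext fun q => by rw [hp q, Pi.single_eq_same]] at this

/-- The linear function `u∂^μ ↦ δ_{μ,0} residue u` on `𝒲`. -/
noncomputable def wResidue (p : Fin (ℓ₁ + (ℓ₂ + ℓ₃ + ℓ₄))) (γ : Γ) : W Γ →ₗ[F] F :=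
  (residue p γ).comp
    (Finsupp.lapply 0 : ((Fin (ℓ₁ + (ℓ₂ + ℓ₃ + ℓ₄)) → ℕ) →₀ A Γ) →ₗ[F] A Γ)

theorem wResidue_ofA (p : Fin (ℓ₁ + (ℓ₂ + ℓ₃ + ℓ₄))) (γ : Γ) (f : A Γ) :
    wResidue p γ (ofA f) = residue p γ f :=
  congrArg (residue p γ) Finsupp.single_eq_same

theorem wResidue_mul_D (p q : Fin (ℓ₁ + (ℓ₂ + ℓ₃ + ℓ₄))) (γ : Γ) (w : W Γ) :
    wResidue p γ (w * D Γ q) = 0 := by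
  induction w using W_induction_mono with
  | h0 => simp
  | hadd v w hv hw => rw [add_mul, map_add, hv, hw, add_zero]
  | hm μ a =>
    rw [mono_mul_D]
    refine (congrArg (residue p γ) (Finsupp.single_eq_of_ne fun h => ?_)).trans (map_zero _)
    have := congrFun h q
    simp at this
    omega

theorem wResidue_mul {p : Fin (ℓ₁ + (ℓ₂ + ℓ₃ + ℓ₄))} (γ : Γ) (f g : A Γ) (m n : ℕ) :
    wResidue p γ (ofA f * D Γ p ^ m * (ofA g * D Γ p ^ n)) =
      if n = 0 then residue p γ (f * (partialOp p ^ m) g) else 0 := by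
  cases n with
  | zero =>
    rw [if_pos rfl, pow_zero, mul_one]
    induction m generalizing g with
    | zero => rw [pow_zero, mul_one, ← map_mul, wResidue_ofA]; rfl
    | succ m ih =>
      have h : D Γ p * ofA g = ofA g * D Γ p + ofA (partialOp p g) := by
        rw [← lie_D_ofA, lie_def]
        abel
      rw [pow_succ, mul_assoc, mul_assoc, h, mul_add, mul_add, map_add, ← mul_assoc, ← mul_assoc,
        ← mul_assoc, wResidue_mul_D, zero_add, ih, pow_succ, Module.End.mul_apply]
  | succ n =>
    rw [if_neg n.succ_ne_zero, pow_succ, ← mul_assoc, ← mul_assoc, wResidue_mul_D]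

theorem lie_mul_D_pow {p : Fin (ℓ₁ + (ℓ₂ + ℓ₃ + ℓ₄))} {t : A Γ} (ht : partialOp p t = 1)
    (f : A Γ) (m : ℕ) : ⁅ofA t, ofA f * D Γ p ^ m⁆ = -((m : F) • (ofA f * D Γ p ^ (m - 1))) := by
  have h1 : ⁅D Γ p, ofA t⁆ = 1 := by rw [lie_D_ofA, ht, map_one]
  rw [lie_mul_right, lie_ofA_ofA, zero_mul, zero_add]
  cases m with
  | zero => simp [lie_def]
  | succ m =>
    refine (congrArg (ofA f * ·) (lie_pow_of_lie_eq_one (R := W Γ) h1 m)).trans ?_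
    simp only [mul_neg, Nat.add_sub_cancel, ← Nat.cast_smul_eq_nsmul F, mul_smul_comm]

/-- Bracketing with t lowers the power of ∂, so both terms involve the same residue with m + n
derivatives. For m, n > 0 they cancel; for m = 0 or n = 0 one of them is absent and the other is the
residue of a product, after integration by parts when n = 0. -/
theorem phi_lie_add [CharZero F] {p : Fin (ℓ₁ + (ℓ₂ + ℓ₃ + ℓ₄))} (hp : ∀ q, q = p)
    (hJ : ∀ i, i ∈ J ℓ₁ ℓ₂ ℓ₃ ℓ₄) {t : A Γ} (ht : partialOp p t = 1) (γ : Γ) (u v : W Γ) :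
    phi p γ ⁅ofA t, u⁆ v + phi p γ u ⁅ofA t, v⁆ = -wResidue p γ ⁅v, u⁆ := by
  induction u using W_induction_pow hp with
  | hadd u u' hu hu' =>
    rw [lie_add, lie_add, LinearMap.map_add₂, LinearMap.map_add₂, map_add, neg_add, ← hu, ← hu']
    abel
  | h f m =>
    induction v using W_induction_pow hp with
    | hadd v v' hv hv' =>
      rw [lie_add, add_lie, map_add (phi p γ _), map_add (phi p γ _), map_add, neg_add, ← hv,
        ← hv']
      abel
    | h g n =>
      rw [lie_mul_D_pow ht, lie_mul_D_pow ht, map_neg, map_neg, LinearMap.neg_apply, map_smul,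
        map_smul, LinearMap.smul_apply, phi_elt hp hJ, phi_elt hp hJ, lie_def, map_sub,
        wResidue_mul, wResidue_mul]
      cases m with
      | zero =>
        cases n with
        | zero => simp [mul_comm]
        | succ n =>
          have h : ((n + 1 : ℕ) : F) * ((n.factorial : F) / ((n + 1).factorial : F)) = 1 := by
            rw [← mul_div_assoc, ← Nat.cast_mul, ← Nat.factorial_succ]
            exact div_self (Nat.cast_ne_zero.2 (Nat.factorial_ne_zero _))
          rw [if_pos rfl, if_neg n.succ_ne_zero, mul_comm g]
          simp only [Nat.cast_zero, zero_add, pow_zero, Nat.factorial_zero, Nat.cast_one, one_mul,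
            Nat.add_sub_cancel, sub_zero, smul_eq_mul, zero_mul, neg_zero]
          linear_combination -residue p γ ((partialOp p ^ (n + 1)) f * g) * h
      | succ m =>
        cases n with
        | zero =>
          have h : ((m + 1 : ℕ) : F) * ((m.factorial : F) / ((m + 1).factorial : F)) = 1 := by
            rw [← mul_div_assoc, ← Nat.cast_mul, ← Nat.factorial_succ]
            exact div_self (Nat.cast_ne_zero.2 (Nat.factorial_ne_zero _))
          rw [if_pos rfl, if_neg m.succ_ne_zero, Nat.add_sub_cancel, add_zero,
            residue_partialOp_pow_mul hJ]
          simp only [Nat.cast_zero, Nat.factorial_zero, zero_sub, Nat.cast_one, mul_one,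
            smul_eq_mul, neg_neg, zero_mul, neg_zero, add_zero]
          obtain h1 | h1 := neg_one_pow_eq_or F m <;> rw [pow_succ, h1] <;>
            linear_combination residue p γ (f * (partialOp p ^ (m + 1)) g) * h
        | succ n =>
          rw [if_neg n.succ_ne_zero, if_neg m.succ_ne_zero, Nat.add_sub_cancel, Nat.add_sub_cancel,
            show m + (n + 1) + 1 = m + n + 2 by ring, show m + 1 + n + 1 = m + n + 2 by ring]
          simp only [Nat.factorial_succ m, Nat.factorial_succ n, Nat.cast_mul, smul_eq_mul,
            pow_succ]
          ring

theorem phi_mem_C2 [CharZero F] {p : Fin (ℓ₁ + (ℓ₂ + ℓ₃ + ℓ₄))} (hp : ∀ q, q = p)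
    (hJ : ∀ i, i ∈ J ℓ₁ ℓ₂ ℓ₃ ℓ₄) {t : A Γ} (ht : partialOp p t = 1) (γ : Γ) :
    phi p γ ∈ C2 F (W Γ) :=
  mem_C2_of_derivation (ι := LieAlgebra.ad F (W Γ) (ofA t))
    (exists_lie_ofA_eq (p := p) (b := 1) (by rw [one_mul, ht]))
    (ad_ofA_locally_nilpotent t) (fun u v => leibniz_lie (ofA t) u v) (phi (Γ := Γ) p γ)
    (-wResidue (Γ := Γ) p γ) fun u v => phi_lie_add hp hJ ht γ u v

end Residue

/-! ### Infinite combinations of the φ_γ and the case ℓ = ℓ₃ = 1 -/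

section PhiFamily

variable {F : Type*} [Field F] {ℓ₁ ℓ₂ ℓ₃ ℓ₄ : ℕ}
  {Γ : AddSubgroup (Fin (ℓ₁ + (ℓ₂ + ℓ₃ + ℓ₄)) → F)}

/-- The forms `φ_γ`, collected into one bilinear map with values in the finitely supported functions
on `Γ`. -/
noncomputable def phiFamily (p : Fin (ℓ₁ + (ℓ₂ + ℓ₃ + ℓ₄))) : W Γ →ₗ[F] W Γ →ₗ[F] (Γ →₀ F) :=
  (eltBasis Γ).constr F fun y => (eltBasis Γ).constr F fun z =>
    -- On a pair of basis elements only γ = α + β can contribute. Finite support is thus built in,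
    -- and arbitrary families of coefficients may be paired with the value.
    Finsupp.single (y.2.1 + z.2.1) (phi p (y.2.1 + z.2.1) (eltBasis Γ y) (eltBasis Γ z))

theorem phiFamily_apply (p : Fin (ℓ₁ + (ℓ₂ + ℓ₃ + ℓ₄))) (γ : Γ) (u v : W Γ) :
    phiFamily p u v γ = phi p γ u v := by
  have h : (phiFamily (Γ := Γ) p).compr₂ (Finsupp.lapply γ) = phi p γ := by
    refine (eltBasis Γ).ext fun y => (eltBasis Γ).ext fun z => ?_
    rw [LinearMap.compr₂_apply, phiFamily, Module.Basis.constr_basis, Module.Basis.constr_basis,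
      Finsupp.lapply_apply]
    by_cases hγ : y.2.1 + z.2.1 = γ
    · rw [hγ, Finsupp.single_eq_same]
    · rw [Finsupp.single_eq_of_ne (Ne.symm hγ), phi, Module.Basis.constr_basis,
        Module.Basis.constr_basis]
      exact (if_neg hγ).symm
  exact LinearMap.congr_fun (LinearMap.congr_fun h u) v

theorem finite_phi_ne_zero (p : Fin (ℓ₁ + (ℓ₂ + ℓ₃ + ℓ₄))) (u v : W Γ) :
    {γ : Γ | phi p γ u v ≠ 0}.Finite := by
  refine (phiFamily p u v).hasFiniteSupport.subset fun γ hγ => ?_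
  rwa [Function.mem_support, phiFamily_apply]

theorem finsum_phi (p : Fin (ℓ₁ + (ℓ₂ + ℓ₃ + ℓ₄))) (b : Γ → F) (u v : W Γ) :
    Finsupp.linearCombination F b (phiFamily p u v) = ∑ᶠ γ : Γ, b γ * phi p γ u v := by
  rw [Finsupp.linearCombination_apply, Finsupp.sum, finsum_eq_sum_of_support_subset]
  · exact Finset.sum_congr rfl fun γ _ => by rw [phiFamily_apply, smul_eq_mul, mul_comm]
  · intro γ hγ
    rw [Finset.mem_coe, Finsupp.mem_support_iff, phiFamily_apply]
    exact right_ne_zero_of_mul hγ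

/-- The linear map that sends a family `(b_γ)` to the cocycle `∑ b_γ φ_γ`. -/
noncomputable def phiSum {p : Fin (ℓ₁ + (ℓ₂ + ℓ₃ + ℓ₄))} (h : ∀ γ : Γ, phi p γ ∈ C2 F (W Γ)) :
    (Γ → F) →ₗ[F] C2 F (W Γ) where
  toFun b := ⟨(phiFamily p).compr₂ (Finsupp.linearCombination F b),
    fun u v => by
      have : phiFamily p u v = -phiFamily p v u := Finsupp.ext fun γ => by
        rw [Finsupp.neg_apply, phiFamily_apply, phiFamily_apply, (h γ).1]
      rw [LinearMap.compr₂_apply, LinearMap.compr₂_apply, this, map_neg],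
    fun u v w => by
      have : phiFamily p ⁅u, v⁆ w + phiFamily p ⁅v, w⁆ u + phiFamily p ⁅w, u⁆ v = 0 :=
        Finsupp.ext fun γ => by
          rw [Finsupp.add_apply, Finsupp.add_apply, phiFamily_apply, phiFamily_apply,
            phiFamily_apply, (h γ).2, Finsupp.zero_apply]
      rw [LinearMap.compr₂_apply, LinearMap.compr₂_apply, LinearMap.compr₂_apply, ← map_add,
        ← map_add, this, map_zero]⟩
  map_add' b c := Subtype.ext <| LinearMap.ext₂ fun u v => by
    show Finsupp.linearCombination F (b + c) (phiFamily p u v) =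
      Finsupp.linearCombination F b (phiFamily p u v) +
        Finsupp.linearCombination F c (phiFamily p u v)
    simp only [Finsupp.linearCombination_apply, Pi.add_apply, smul_add, Finsupp.sum_add]
  map_smul' a b := Subtype.ext <| LinearMap.ext₂ fun u v => by
    show Finsupp.linearCombination F (a • b) (phiFamily p u v) =
      a * Finsupp.linearCombination F b (phiFamily p u v)
    simp only [Finsupp.linearCombination_apply, Pi.smul_apply, smul_eq_mul, Finsupp.mul_sum,
      mul_left_comm]

theorem phiSum_apply {p : Fin (ℓ₁ + (ℓ₂ + ℓ₃ + ℓ₄))} (h : ∀ γ : Γ, phi p γ ∈ C2 F (W Γ))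
    (b : Γ → F) (u v : W Γ) : (phiSum h b).1 u v = ∑ᶠ γ : Γ, b γ * phi p γ u v :=
  finsum_phi p b u v

variable [CharZero F] {p : Fin (ℓ₁ + (ℓ₂ + ℓ₃ + ℓ₄))}

theorem phi_ofA (hp : ∀ q, q = p) (hJ : ∀ i, i ∈ J ℓ₁ ℓ₂ ℓ₃ ℓ₄) {t : A Γ} (ht : partialOp p t = 1)
    (γ : Γ) (f : A Γ) : phi p γ (ofA t) (ofA f) = residue p γ f := by
  have h := phi_elt hp hJ γ 0 0 t f
  simpa [ht] using h

/-- These values recover the coefficients. As t commutes with functions, coboundaries vanish at the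
same pairs, which gives injectivity into H². -/
theorem phiSum_ofA_xpow (hp : ∀ q, q = p) (hJ : ∀ i, i ∈ J ℓ₁ ℓ₂ ℓ₃ ℓ₄) {t : A Γ}
    (ht : partialOp p t = 1) (h : ∀ γ : Γ, phi p γ ∈ C2 F (W Γ)) (b : Γ → F) (γ : Γ) :
    (phiSum h b).1 (ofA t) (ofA (xpow γ (Pi.single p (-1)))) = b γ := by
  rw [phiSum_apply, finsum_eq_single _ γ fun δ hδ => ?_]
  · rw [phi_ofA hp hJ ht, residue_xpow p γ γ (hJ _), if_pos rfl, Pi.single_eq_same, neg_neg,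
      sub_self, divPow_zero, mul_one]
  · rw [phi_ofA hp hJ ht, residue_xpow p δ γ (hJ _), if_neg hδ.symm, mul_zero]

theorem mem_B2_of_xpow_neg_one_eq_zero (hp : ∀ q, q = p) (hJ : ∀ i, i ∈ J ℓ₁ ℓ₂ ℓ₃ ℓ₄) {t : A Γ}
    (ht : partialOp p t = 1) (ψ : C2 F (W Γ))
    (hψ : ∀ γ : Γ, ψ.1 (ofA t) (ofA (xpow γ (Pi.single p (-1)))) = 0) : ψ ∈ B2 F (W Γ) := by
  have h1 : 1 * partialOp p t = 1 := by rw [one_mul, ht]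
  have hs := exists_lie_ofA_eq h1
  refine mem_B2_of_forall_centralizer (ofA t) hs (ad_ofA_locally_nilpotent _) ψ fun w hw => ?_
  obtain ⟨f, rfl⟩ := exists_eq_ofA_of_lie_eq_zero hp h1 hw
  clear hw
  -- As [t, ∂] = -1 is central, ψ(t, ·) kills derivatives. Applied to x^{γ,k} this is the recursion
  -- solved by `eq_zero_of_recursion`.
  have hd : ∀ f, ψ.1 (ofA t) (ofA (partialOp p f)) = 0 := fun f => by
    have h := ψ.2.2 (ofA t) (D Γ p) (ofA f)
    rw [lie_ofA_D, lie_D_ofA, lie_ofA_ofA, map_zero, ht, map_one, map_neg, LinearMap.neg_apply,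
      cocycle_one_eq_zero ψ hs, neg_zero, zero_add, LinearMap.zero_apply, add_zero] at h
    rw [ψ.2.1, h, neg_zero]
  induction f using A_induction with
  | hadd f g hf hg => rw [map_add, map_add, hf, hg, add_zero]
  | hsmul c f hf => rw [map_smul, map_smul, hf, smul_zero]
  | h γ i hi =>
    have hsingle : ∀ i : Fin (ℓ₁ + (ℓ₂ + ℓ₃ + ℓ₄)) → ℤ, Pi.single p (i p) = i := fun i =>
      funext fun q => by rw [hp q, Pi.single_eq_same]
    have := eq_zero_of_recursion (c := γ.1 p)
      (a := fun k => ψ.1 (ofA t) (ofA (xpow γ (Pi.single p k)))) (fun k => ?_) (hψ γ) (i p)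
    · simpa only [hsingle] using this
    · have h := hd (xpow γ (Pi.single p k))
      rw [partialOp_xpow p γ (hJ _), map_add, map_add, map_smul, map_smul, map_smul, map_smul,
        Pi.single_eq_same, ← Pi.single_sub] at h
      exact h

theorem H2_of_l3 (hp : ∀ q, q = p) (hJ : ∀ i, i ∈ J ℓ₁ ℓ₂ ℓ₃ ℓ₄) {t : A Γ}
    (ht : partialOp p t = 1) : (∀ γ : Γ, phi p γ ∈ C2 F (W Γ)) ∧
      (∀ u v : W Γ, {γ : Γ | phi p γ u v ≠ 0}.Finite) ∧
      ∃ Φ : (Γ → F) ≃ₗ[F] H2 F (W Γ), ∀ b : Γ → F, ∃ ψ : C2 F (W Γ),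
        (∀ u v : W Γ, ψ.1 u v = ∑ᶠ γ : Γ, b γ * phi p γ u v) ∧
        Φ b = Submodule.Quotient.mk ψ := by
  have h := fun γ : Γ => phi_mem_C2 hp hJ ht γ
  refine ⟨h, finite_phi_ne_zero p,
    LinearEquiv.ofBijective ((B2 F (W Γ)).mkQ.comp (phiSum h)) ⟨?_, ?_⟩,
    fun b => ⟨phiSum h b, phiSum_apply h b, rfl⟩⟩
  · refine (injective_iff_map_eq_zero _).2 fun b hb => funext fun γ => ?_
    obtain ⟨f, hf⟩ := (Submodule.Quotient.mk_eq_zero _).1 hb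
    have h2 := coboundary_apply f (ofA t) (ofA (xpow γ (Pi.single p (-1))))
    rw [hf, lie_ofA_ofA, map_zero, phiSum_ofA_xpow hp hJ ht] at h2
    exact h2
  · rintro ⟨ψ⟩
    -- The coefficients are read off from ψ, so that the difference vanishes at every pair (t,
    -- x^{γ,-1}).
    refine ⟨fun γ => ψ.1 (ofA t) (ofA (xpow γ (Pi.single p (-1)))),
      ((Submodule.Quotient.eq _).2 ?_).symm⟩
    refine mem_B2_of_xpow_neg_one_eq_zero hp hJ ht _ fun γ => ?_
    exact sub_eq_zero.2 (phiSum_ofA_xpow hp hJ ht h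
      (fun γ => ψ.1 (ofA t) (ofA (xpow γ (Pi.single p (-1))))) γ).symm

end PhiFamily

end GenDiffOp

open GenDiffOp in
theorem theorem3p1 {F : Type*} [Field F] [CharZero F] (ℓ₁ ℓ₂ ℓ₃ ℓ₄ : ℕ)
    (hℓ : 0 < ℓ₁ + (ℓ₂ + ℓ₃ + ℓ₄)) (Γ : AddSubgroup (Fin (ℓ₁ + (ℓ₂ + ℓ₃ + ℓ₄)) → F))
    (hΓ : IsAdmissible Γ) :
    (ℓ₁ + ℓ₂ ≠ 0 ∨ 2 ≤ ℓ₁ + (ℓ₂ + ℓ₃ + ℓ₄) → Subsingleton (H2 F (W Γ))) ∧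
    (ℓ₁ + (ℓ₂ + ℓ₃ + ℓ₄) = 1 → ℓ₄ = 1 →
      ∃ φ₀ : C2 F (W Γ), IsPhiZero ⟨0, hℓ⟩ φ₀.1 ∧
        (∀ ψ : W Γ →ₗ[F] W Γ →ₗ[F] F, IsPhiZero ⟨0, hℓ⟩ ψ → ψ = φ₀.1) ∧
        (Submodule.Quotient.mk φ₀ : H2 F (W Γ)) ≠ 0 ∧
        Submodule.span F {(Submodule.Quotient.mk φ₀ : H2 F (W Γ))} = ⊤) ∧
    (ℓ₁ + (ℓ₂ + ℓ₃ + ℓ₄) = 1 → ℓ₃ = 1 →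
      (∀ γ : Γ, phi ⟨0, hℓ⟩ γ ∈ C2 F (W Γ)) ∧
      (∀ u v : W Γ, {γ : Γ | phi ⟨0, hℓ⟩ γ u v ≠ 0}.Finite) ∧
      ∃ Φ : (Γ → F) ≃ₗ[F] H2 F (W Γ), ∀ b : Γ → F, ∃ ψ : C2 F (W Γ),
        (∀ u v : W Γ, ψ.1 u v = ∑ᶠ γ : Γ, b γ * phi ⟨0, hℓ⟩ γ u v) ∧
        Φ b = Submodule.Quotient.mk ψ) := by
  refine ⟨subsingleton_H2 hΓ, fun h h4 => ?_, fun h h3 => ?_⟩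
  · have hp : ∀ q : Fin (ℓ₁ + (ℓ₂ + ℓ₃ + ℓ₄)), q = ⟨0, hℓ⟩ := fun q => Fin.ext (by
      have := q.2
      show q.val = 0
      omega)
    obtain ⟨α, q, hα⟩ := hΓ.exists_ne_zero (by omega)
    rw [hp q] at hα
    refine H2_of_l4 hp (fun i hi => funext fun q => hi.2 q (by omega)) hα
  · have hp : ∀ q : Fin (ℓ₁ + (ℓ₂ + ℓ₃ + ℓ₄)), q = ⟨0, hℓ⟩ := fun q => Fin.ext (by
      have := q.2
      show q.val = 0
      omega)
    have hlt : (⟨0, hℓ⟩ : Fin (ℓ₁ + (ℓ₂ + ℓ₃ + ℓ₄))).val < ℓ₁ + ℓ₂ + ℓ₃ := by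
      show 0 < ℓ₁ + ℓ₂ + ℓ₃
      omega
    -- Here ℓ₁ + ℓ₂ = 0 and ℓ₄ = 0, so both conditions defining `J` are vacuous; t is the coordinate
    -- function x^{0,1}.
    refine H2_of_l3 hp (fun i => ⟨fun q hq => ?_, fun q hq => ?_⟩)
      ((partialOp_xpow_single hlt _).trans (if_pos rfl))
    · omega
    · have := q.2
      omega
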